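/- **Theorem.** Let $I\subset\mathbb R$ be a nonempty open interval, and let $c=c(u)$, $q=q(u)$ be arbitrary smooth real functions on $I$ such that $q'(u)\neq 0$ for all $u\in I$. Primes and superscripts $(k)$ denote derivatives with respect to $u$. Put $$p(u)=\frac{c^2}{960}\left[5\,\frac{c'}{c}-\frac{q''}{q'}\right]:=\frac{1}{960}\left(5\,c\,c'-\frac{c^2q''}{q'}\right).$$ *Conventions.* A differential polynomial is a polynomial in $u_x,u_{xx},\dots$ whose coefficients are smooth functions of $u\in I$; it is graded by $\deg u^{(k)}=k$ for $k\ge 1$, functions of $u$ having degree $0$. Local functionals $H=\int h\,dx$ have formal power series $h$ in $\epsilon$ of differential polynomials as densities, taken modulo total $x$-derivatives, and $\frac{\delta H}{\delta u(x)}=\sum_{k\ge0}(-\partial_x)^k\frac{\partial h}{\partial u^{(k)}}$. A bracket $\{u(x),u(y)\}=\sum_{k\ge 0}\epsilon^k\sum_{s} A_{k,s}(u;u_x,\dots)\,\delta^{(s)}(x-y)$, with $A_{k,s}$ evaluated at $x$, acts by $$\{F,G\}=\int\frac{\delta F}{\delta u(x)}\,\Bigl(\sum_{k,s}\epsilon^kA_{k,s}\,\partial_x^s\Bigr)\frac{\delta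 G}{\delta u(x)}\,dx .$$ It is called graded if $A_{k,s}$ is homogeneous of degree $k+1-s$ (and zero for $s>k+1$). A functional is $O(\epsilon^6)$ if the coefficients of $\epsilon^0,\dots,\epsilon^5$ of its density are total $x$-derivatives of differential polynomials. For a smooth function $f=f(u)$ on $I$ let $H_f=\int h_f\,dx$, where $$h_f=f-\frac{\epsilon^2}{24}\,c\,f'''u_x^2+\epsilon^4\left[\left(p\,f'''+\frac{c^2f^{(4)}}{480}\right)u_{xx}^2-\left(\frac{c\,c''f^{(4)}}{1152}+\frac{c\,c'f^{(5)}}{1152}+\frac{c^2f^{(6)}}{3456}+\frac{p'f^{(4)}}{6}+\frac{p\,f^{(5)}}{6}\right)u_x^4\right].$$ Let $$\{u(x),u(y)\}_1=\delta'(x-y),\qquad \{u(x),u(y)\}_2=\{u(x),u(y)\}_2^{[0]}+\epsilon^2\{u(x),u(y)\}_2^{[2]}+\epsilon^4\{u(x),u(y)\}_2^{[4]},$$ where $$\{u(x),u(y)\}_2^{[0]}=q(u)\,\delta'(x-y)+\tfrac12 q'(u)\,u_x\,\delta(x-y),$$ $$\{u(x),u(y)\}_2^{[2]}=\begin{aligned}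 &\Bigl[\Bigl(\frac{c\,q'}{8}\Bigr)\Bigr]\delta'''(x-y)\\ &+\Bigl[\Bigl(\frac{3\,c'\,q'}{16}+\frac{3\,c\,q''}{16}\Bigr)u_{x}\Bigr]\delta''(x-y)\\ &+\Bigl[\Bigl(\frac{c''\,q'}{16}+\frac{c'\,q''}{6}+\frac{5\,c\,q'''}{48}\Bigr)u_{x}^{2}\\ &\quad+\Bigl(\frac{c'\,q'}{16}+\frac{7\,c\,q''}{48}\Bigr)u_{xx}\Bigr]\delta'(x-y)\\ &+\Bigl[\Bigl(\frac{c''\,q''}{48}+\frac{c'\,q'''}{24}+\frac{c\,q^{(4)}}{48}\Bigr)u_{x}^{3}\\ &\quad+\Bigl(\frac{c'\,q''}{12}+\frac{c\,q'''}{12}\Bigr)u_{x}\,u_{xx}\\ &\quad+\Bigl(\frac{c\,q''}{24}\Bigr)u_{xxx}\Bigr]\delta(x-y) \end{aligned}$$ and $$\{u(x),u(y)\}_2^{[4]}=\begin{aligned} &\Bigl[\Bigl(\frac{c\,c'\,q'}{64}+\frac{c^{2}\,q''}{192}\Bigr)\Bigr]\delta^{(5)}(x-y)\\ &+\Bigl[\Bigl(\frac{5\,{(c')}^{2}\,q'}{128}+\frac{5\,c\,c''\,q'}{128}+\frac{25\,c\,c'\,q''}{384}+\frac{5\,c^{2}\,q'''}{384}\Bigr)u_{x}\Bigr]\delta^{(4)}(x-y)\\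 &+\Bigl[\Bigl(\frac{3\,c'\,c''\,q'}{32}+\frac{c\,c'''\,q'}{32}+\frac{3\,{(c')}^{2}\,q''}{32}+\frac{5\,c\,c''\,q''}{48}+\frac{c^{2}\,{(q'')}^{3}}{480\,{(q')}^{2}}+\frac{19\,c\,c'\,q'''}{192}-\frac{3\,c^{2}\,q''\,q'''}{640\,q'}+\frac{c^{2}\,q^{(4)}}{64}-\frac{c\,c'\,{(q'')}^{2}}{240\,q'}\Bigr)u_{x}^{2}\\ &\quad+\Bigl(\frac{3\,{(c')}^{2}\,q'}{64}+\frac{3\,c\,c''\,q'}{64}+\frac{17\,c\,c'\,q''}{192}-\frac{c^{2}\,{(q'')}^{2}}{480\,q'}+\frac{19\,c^{2}\,q'''}{960}\Bigr)u_{xx}\Bigr]\delta'''(x-y)\\ &+\Bigl[\Bigl(\frac{3\,{(c'')}^{2}\,q'}{128}+\frac{c'\,c'''\,q'}{32}+\frac{c\,c^{(4)}\,q'}{128}+\frac{19\,c'\,c''\,q''}{128}+\frac{23\,c\,c'''\,q''}{384}+\frac{5\,c\,c'\,q^{(4)}}{64}+\frac{7\,c\,c''\,q'''}{64}+\frac{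c^{2}\,q^{(5)}}{96}+\frac{3\,{(c')}^{2}\,q'''}{32}-\frac{{(c')}^{2}\,{(q'')}^{2}}{160\,q'}-\frac{c\,c''\,{(q'')}^{2}}{160\,q'}+\frac{c\,c'\,{(q'')}^{3}}{80\,{(q')}^{2}}-\frac{c^{2}\,{(q'')}^{4}}{160\,{(q')}^{3}}-\frac{17\,c\,c'\,q''\,q'''}{640\,q'}+\frac{21\,c^{2}\,{(q'')}^{2}\,q'''}{1280\,{(q')}^{2}}-\frac{9\,c^{2}\,{(q''')}^{2}}{1280\,q'}-\frac{9\,c^{2}\,q''\,q^{(4)}}{1280\,q'}\Bigr)u_{x}^{3}\\ &\quad+\Bigl(\frac{9\,c'\,c''\,q'}{64}+\frac{3\,c\,c'''\,q'}{64}+\frac{11\,{(c')}^{2}\,q''}{64}+\frac{13\,c\,c''\,q''}{64}-\frac{3\,c\,c'\,{(q'')}^{2}}{160\,q'}+\frac{3\,c^{2}\,{(q'')}^{3}}{320\,{(q')}^{2}}+\frac{69\,c\,c'\,q'''}{320}-\frac{13\,c^{2}\,q''\,q'''}{640\,q'}+\frac{3\,c^{2}\,q^{(4)}}{80}\Bigr)u_{x}\,u_{xx}\\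 &\quad+\Bigl(\frac{{(c')}^{2}\,q'}{32}+\frac{c\,c''\,q'}{32}+\frac{13\,c\,c'\,q''}{192}-\frac{c^{2}\,{(q'')}^{2}}{320\,q'}+\frac{c^{2}\,q'''}{60}\Bigr)u_{xxx}\Bigr]\delta''(x-y)\\ &+\Bigl[\Bigl(\frac{{(c'')}^{2}\,q''}{48}+\frac{c'\,c'''\,q''}{32}+\frac{c\,c^{(4)}\,q''}{96}-\frac{c'\,c''\,{(q'')}^{2}}{160\,q'}-\frac{c\,c'''\,{(q'')}^{2}}{480\,q'}+\frac{{(c')}^{2}\,{(q'')}^{3}}{160\,{(q')}^{2}}+\frac{c\,c''\,{(q'')}^{3}}{160\,{(q')}^{2}}-\frac{c\,c'\,{(q'')}^{4}}{80\,{(q')}^{3}}+\frac{c^{2}\,{(q'')}^{5}}{160\,{(q')}^{4}}+\frac{35\,c'\,c''\,q'''}{384}+\frac{5\,c\,c'''\,q'''}{128}-\frac{9\,{(c')}^{2}\,q''\,q'''}{640\,q'}-\frac{9\,c\,c''\,q''\,q'''}{640\,q'}+\frac{11\,c\,c'\,{(q'')}^{2}\,q'''}{320\,{(q')}^{2}}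-\frac{13\,c^{2}\,{(q'')}^{3}\,q'''}{640\,{(q')}^{3}}-\frac{c\,c'\,{(q''')}^{2}}{64\,q'}+\frac{19\,c^{2}\,q''\,{(q''')}^{2}}{1280\,{(q')}^{2}}+\frac{17\,{(c')}^{2}\,q^{(4)}}{384}+\frac{5\,c\,c''\,q^{(4)}}{96}-\frac{c\,c'\,q''\,q^{(4)}}{64\,q'}+\frac{17\,c^{2}\,{(q'')}^{2}\,q^{(4)}}{1920\,{(q')}^{2}}-\frac{11\,c^{2}\,q'''\,q^{(4)}}{1280\,q'}+\frac{35\,c\,c'\,q^{(5)}}{1152}-\frac{11\,c^{2}\,q''\,q^{(5)}}{3840\,q'}+\frac{c^{2}\,q^{(6)}}{288}\Bigr)u_{x}^{4}\\ &\quad+\Bigl(\frac{3\,{(c'')}^{2}\,q'}{128}+\frac{c'\,c'''\,q'}{32}+\frac{c\,c^{(4)}\,q'}{128}+\frac{91\,c'\,c''\,q''}{384}+\frac{37\,c\,c'''\,q''}{384}-\frac{{(c')}^{2}\,{(q'')}^{2}}{60\,q'}-\frac{c\,c''\,{(q'')}^{2}}{60\,q'}+\frac{c\,c'\,{(q'')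}^{3}}{30\,{(q')}^{2}}-\frac{c^{2}\,{(q'')}^{4}}{60\,{(q')}^{3}}+\frac{59\,{(c')}^{2}\,q'''}{320}+\frac{53\,c\,c''\,q'''}{240}-\frac{47\,c\,c'\,q''\,q'''}{640\,q'}+\frac{173\,c^{2}\,{(q'')}^{2}\,q'''}{3840\,{(q')}^{2}}-\frac{77\,c^{2}\,{(q''')}^{2}}{3840\,q'}+\frac{169\,c\,c'\,q^{(4)}}{960}-\frac{77\,c^{2}\,q''\,q^{(4)}}{3840\,q'}+\frac{73\,c^{2}\,q^{(5)}}{2880}\Bigr)u_{x}^{2}\,u_{xx}\\ &\quad+\Bigl(\frac{3\,c'\,c''\,q'}{128}+\frac{c\,c'''\,q'}{128}+\frac{5\,{(c')}^{2}\,q''}{96}+\frac{c\,c''\,q''}{16}-\frac{c\,c'\,{(q'')}^{2}}{80\,q'}+\frac{c^{2}\,{(q'')}^{3}}{160\,{(q')}^{2}}+\frac{157\,c\,c'\,q'''}{1920}-\frac{5\,c^{2}\,q''\,q'''}{384\,q'}+\frac{31\,c^{2}\,q^{(4)}}{1920}\Bigr)u_{xx}^{2}\\ &\quad+\Bigl(\frac{3\,c'\,c''\,q'}{64}+\frac{c\,c'''\,q'}{64}+\frac{{(c')}^{2}\,q''}{12}+\frac{3\,c\,c''\,q''}{32}-\frac{c\,c'\,{(q'')}^{2}}{60\,q'}+\frac{c^{2}\,{(q'')}^{3}}{120\,{(q')}^{2}}+\frac{19\,c\,c'\,q'''}{160}-\frac{11\,c^{2}\,q''\,q'''}{640\,q'}+\frac{11\,c^{2}\,q^{(4)}}{480}\Bigr)u_{x}\,u_{xxx}\\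 &\quad+\Bigl(\frac{{(c')}^{2}\,q'}{128}+\frac{c\,c''\,q'}{128}+\frac{11\,c\,c'\,q''}{384}-\frac{c^{2}\,{(q'')}^{2}}{320\,q'}+\frac{17\,c^{2}\,q'''}{1920}\Bigr)u_{xxxx}\Bigr]\delta'(x-y)\\ &+\Bigl[\Bigl(\frac{{(c'')}^{2}\,q'''}{192}+\frac{c'\,c'''\,q'''}{128}+\frac{c\,c^{(4)}\,q'''}{384}-\frac{c'\,c''\,q''\,q'''}{640\,q'}-\frac{c\,c'''\,q''\,q'''}{1920\,q'}+\frac{{(c')}^{2}\,{(q'')}^{2}\,q'''}{640\,{(q')}^{2}}+\frac{c\,c''\,{(q'')}^{2}\,q'''}{640\,{(q')}^{2}}-\frac{c\,c'\,{(q'')}^{3}\,q'''}{320\,{(q')}^{3}}+\frac{c^{2}\,{(q'')}^{4}\,q'''}{640\,{(q')}^{4}}-\frac{{(c')}^{2}\,{(q''')}^{2}}{640\,q'}-\frac{c\,c''\,{(q''')}^{2}}{640\,q'}+\frac{3\,c\,c'\,q''\,{(q''')}^{2}}{640\,{(q')}^{2}}-\frac{c^{2}\,{(q'')}^{2}\,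{(q''')}^{2}}{320\,{(q')}^{3}}+\frac{c^{2}\,{(q''')}^{3}}{1280\,{(q')}^{2}}+\frac{7\,c'\,c''\,q^{(4)}}{384}+\frac{c\,c'''\,q^{(4)}}{128}-\frac{{(c')}^{2}\,q''\,q^{(4)}}{640\,q'}-\frac{c\,c''\,q''\,q^{(4)}}{640\,q'}+\frac{c\,c'\,{(q'')}^{2}\,q^{(4)}}{320\,{(q')}^{2}}-\frac{c^{2}\,{(q'')}^{3}\,q^{(4)}}{640\,{(q')}^{3}}-\frac{3\,c\,c'\,q'''\,q^{(4)}}{640\,q'}+\frac{13\,c^{2}\,q''\,q'''\,q^{(4)}}{3840\,{(q')}^{2}}-\frac{c^{2}\,{(q^{(4)})}^{2}}{1280\,q'}+\frac{17\,{(c')}^{2}\,q^{(5)}}{2304}+\frac{5\,c\,c''\,q^{(5)}}{576}-\frac{c\,c'\,q''\,q^{(5)}}{640\,q'}+\frac{c^{2}\,{(q'')}^{2}\,q^{(5)}}{1280\,{(q')}^{2}}-\frac{c^{2}\,q'''\,q^{(5)}}{960\,q'}+\frac{5\,c\,c'\,q^{(6)}}{1152}-\frac{c^{2}\,q''\,q^{(6)}}{3840\,q'}+\frac{c^{2}\,q^{(7)}}{2304}\Bigr)u_{x}^{5}\\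 &\quad+\Bigl(\frac{{(c'')}^{2}\,q''}{64}+\frac{c'\,c'''\,q''}{48}+\frac{c\,c^{(4)}\,q''}{192}-\frac{c'\,c''\,{(q'')}^{2}}{160\,q'}-\frac{c\,c'''\,{(q'')}^{2}}{480\,q'}+\frac{{(c')}^{2}\,{(q'')}^{3}}{160\,{(q')}^{2}}+\frac{c\,c''\,{(q'')}^{3}}{160\,{(q')}^{2}}-\frac{c\,c'\,{(q'')}^{4}}{80\,{(q')}^{3}}+\frac{c^{2}\,{(q'')}^{5}}{160\,{(q')}^{4}}+\frac{97\,c'\,c''\,q'''}{960}+\frac{13\,c\,c'''\,q'''}{320}-\frac{{(c')}^{2}\,q''\,q'''}{60\,q'}-\frac{c\,c''\,q''\,q'''}{60\,q'}+\frac{19\,c\,c'\,{(q'')}^{2}\,q'''}{480\,{(q')}^{2}}-\frac{11\,c^{2}\,{(q'')}^{3}\,q'''}{480\,{(q')}^{3}}-\frac{c\,c'\,{(q''')}^{2}}{48\,q'}+\frac{3\,c^{2}\,q''\,{(q''')}^{2}}{160\,{(q')}^{2}}+\frac{19\,{(c')}^{2}\,q^{(4)}}{320}+\frac{67\,c\,c''\,q^{(4)}}{960}-\frac{c\,c'\,q''\,q^{(4)}}{48\,q'}+\frac{11\,c^{2}\,{(q'')}^{2}\,q^{(4)}}{960\,{(q')}^{2}}-\frac{c^{2}\,q'''\,q^{(4)}}{80\,q'}+\frac{131\,c\,c'\,q^{(5)}}{2880}-\frac{c^{2}\,q''\,q^{(5)}}{240\,q'}+\frac{c^{2}\,q^{(6)}}{180}\Bigr)u_{x}^{3}\,u_{xx}\\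 &\quad+\Bigl(\frac{7\,c'\,c''\,q''}{128}+\frac{7\,c\,c'''\,q''}{384}-\frac{7\,{(c')}^{2}\,{(q'')}^{2}}{960\,q'}-\frac{7\,c\,c''\,{(q'')}^{2}}{960\,q'}+\frac{7\,c\,c'\,{(q'')}^{3}}{480\,{(q')}^{2}}-\frac{7\,c^{2}\,{(q'')}^{4}}{960\,{(q')}^{3}}+\frac{59\,{(c')}^{2}\,q'''}{960}+\frac{23\,c\,c''\,q'''}{320}-\frac{c\,c'\,q''\,q'''}{30\,q'}+\frac{13\,c^{2}\,{(q'')}^{2}\,q'''}{640\,{(q')}^{2}}-\frac{3\,c^{2}\,{(q''')}^{2}}{320\,q'}+\frac{131\,c\,c'\,q^{(4)}}{1920}-\frac{3\,c^{2}\,q''\,q^{(4)}}{320\,q'}+\frac{31\,c^{2}\,q^{(5)}}{2880}\Bigr)u_{x}\,u_{xx}^{2}\\ &\quad+\Bigl(\frac{3\,c'\,c''\,q''}{64}+\frac{c\,c'''\,q''}{64}-\frac{{(c')}^{2}\,{(q'')}^{2}}{160\,q'}-\frac{c\,c''\,{(q'')}^{2}}{160\,q'}+\frac{c\,c'\,{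(q'')}^{3}}{80\,{(q')}^{2}}-\frac{c^{2}\,{(q'')}^{4}}{160\,{(q')}^{3}}+\frac{47\,{(c')}^{2}\,q'''}{960}+\frac{13\,c\,c''\,q'''}{240}-\frac{13\,c\,c'\,q''\,q'''}{480\,q'}+\frac{c^{2}\,{(q'')}^{2}\,q'''}{60\,{(q')}^{2}}-\frac{7\,c^{2}\,{(q''')}^{2}}{960\,q'}+\frac{49\,c\,c'\,q^{(4)}}{960}-\frac{7\,c^{2}\,q''\,q^{(4)}}{960\,q'}+\frac{23\,c^{2}\,q^{(5)}}{2880}\Bigr)u_{x}^{2}\,u_{xxx}\\ &\quad+\Bigl(\frac{5\,{(c')}^{2}\,q''}{192}+\frac{5\,c\,c''\,q''}{192}-\frac{c\,c'\,{(q'')}^{2}}{96\,q'}+\frac{c^{2}\,{(q'')}^{3}}{192\,{(q')}^{2}}+\frac{3\,c\,c'\,q'''}{64}-\frac{c^{2}\,q''\,q'''}{96\,q'}+\frac{c^{2}\,q^{(4)}}{96}\Bigr)u_{xx}\,u_{xxx}\\ &\quad+\Bigl(\frac{{(c')}^{2}\,q''}{64}+\frac{c\,c''\,q''}{64}-\frac{c\,c'\,{(q'')}^{2}}{160\,q'}+\frac{c^{2}\,{(q'')}^{3}}{320\,{(q')}^{2}}+\frac{9\,c\,c'\,q'''}{320}-\frac{c^{2}\,q''\,q'''}{160\,q'}+\frac{c^{2}\,q^{(4)}}{160}\Bigr)u_{x}\,u_{xxxx}\\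 &\quad+\Bigl(\frac{c\,c'\,q''}{192}-\frac{c^{2}\,{(q'')}^{2}}{960\,q'}+\frac{c^{2}\,q'''}{480}\Bigr)u_{xxxxx}\Bigr]\delta(x-y) \end{aligned}$$ Then: 1. (Commutativity) $\{H_f,H_g\}_1=O(\epsilon^6)$ and $\{H_f,H_g\}_2=O(\epsilon^6)$ for all smooth functions $f,g$ on $I$. 2. (Poisson pencil) The bracket $\{\ ,\ \}_1$ and, for every $\lambda\in\mathbb R$, the bracket $\{\ ,\ \}_2-\lambda\{\ ,\ \}_1$ are antisymmetric and satisfy the Jacobi identity modulo $O(\epsilon^6)$ on all local functionals. 3. (Uniqueness) The bracket $\{\ ,\ \}_2$ is graded, and its higher order terms are uniquely determined by the commutativity: if $\{\ ,\ \}$ is any graded bracket with the same term of order $\epsilon^0$, $q(u)\,\delta'(x-y)+\frac12q'(u)\,u_x\,\delta(x-y)$, and $\{H_f,H_g\}=O(\epsilon^6)$ for all smooth $f,g$ on $I$, then its terms of orders $\epsilon^1,\dots,\epsilon^5$ coincide with those of $\{\ ,\ \}_2$; in particular those of orders $\epsilon$, $\epsilon^3$, $\epsilon^5$ vanish. -/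

import Mathlib

open scoped ContDiff

noncomputable section

namespace FormalVar

open MvPolynomial

/-! ## Smooth functions of `u` on an open set of the real line -/

/-- The real algebra of smooth real-valued functions on the open set `I` of the line.  A function
on `I` is smooth when its extension by zero to the line is smooth on `I`. -/
def SmoothFun (I : TopologicalSpace.Opens ℝ) : Subalgebra ℝ (I → ℝ) where
  carrier := {f | ContDiffOn ℝ ∞ (Function.extend Subtype.val f 0) I}
  mul_mem' := by
    intro f g hf hg
    refine (ContDiffOn.mul hf hg).congr fun x hx => ?_
    lift x to I using hx
    simp
  add_mem' := by
    intro f g hf hg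
    refine (ContDiffOn.add hf hg).congr fun x hx => ?_
    lift x to I using hx
    simp
  algebraMap_mem' := by
    intro a
    refine (contDiffOn_const (c := a)).congr fun x hx => ?_
    lift x to I using hx
    simp

variable {I : TopologicalSpace.Opens ℝ}

/-- The derivative `f ↦ f'` of smooth functions on `I`. -/
def D (f : SmoothFun I) : SmoothFun I :=
  ⟨fun x => deriv (Function.extend Subtype.val f.1 0) x, by
    have h : ContDiffOn ℝ ∞ (Function.extend Subtype.val f.1 0) I := f.2
    have h' := h.deriv_of_isOpen (m := ∞) I.isOpen (by simp)
    refine h'.congr fun x hx => ?_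
    lift x to I using hx
    simp⟩

/-- The reciprocal `1 / f` of a nowhere vanishing smooth function on `I`. -/
def recip (f : SmoothFun I) (hf : ∀ x, f.1 x ≠ 0) : SmoothFun I :=
  ⟨fun x => (f.1 x)⁻¹, by
    have h : ContDiffOn ℝ ∞ (Function.extend Subtype.val f.1 0) I := f.2
    have h' := h.inv (by
      intro x hx
      lift x to I using hx
      simpa [Subtype.val_injective.extend_apply] using hf x)
    refine h'.congr fun x hx => ?_
    lift x to I using hx
    simp⟩

/-! ## Differential polynomials -/

/-- Differential polynomials `h(u; u_x, u_xx, …)`: polynomials in the derivatives of `u`, with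
coefficients smooth functions of `u`.  The variable `X k` stands for `u^{(k+1)}`. -/
abbrev DiffPoly (I : TopologicalSpace.Opens ℝ) : Type := MvPolynomial ℕ (SmoothFun I)

/-- `u_x` -/
abbrev ux : DiffPoly I := X 0
/-- `u_xx` -/
abbrev uxx : DiffPoly I := X 1
/-- `u_xxx` -/
abbrev uxxx : DiffPoly I := X 2
/-- `u_xxxx` -/
abbrev uxxxx : DiffPoly I := X 3
/-- `u_xxxxx` -/
abbrev uxxxxx : DiffPoly I := X 4

/-- Homogeneity of degree `d` for the grading `deg u^{(k)} = k`, `deg u = 0`. -/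
def IsHomog (h : DiffPoly I) (d : ℕ) : Prop :=
  IsWeightedHomogeneous (fun k : ℕ => k + 1) h d

/-- The partial derivative `∂/∂u`, differentiating the coefficients. -/
def partialU (h : DiffPoly I) : DiffPoly I :=
  ∑ m ∈ h.support, monomial m (D (coeff m h))

/-- The total derivative `∂_x = u_x ∂/∂u + ∑_{k ≥ 1} u^{(k+1)} ∂/∂u^{(k)}`. -/
def dx (h : DiffPoly I) : DiffPoly I :=
  ux * partialU h + ∑ k ∈ h.vars, X (k + 1) * pderiv k h

/-- The Euler-Lagrange operator `∂/∂u - ∂_x ∂/∂u_x + ∂_x² ∂/∂u_xx - …`; it takes the density `h`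
to the variational derivative of `∫ h dx`. -/
def euler (h : DiffPoly I) : DiffPoly I :=
  partialU h + ∑ k ∈ h.vars, (-1) ^ (k + 1) * dx^[k + 1] (pderiv k h)

/-! ## Local functionals and local brackets, as formal series in `ε` -/

/-- A density `∑_n ε^n h_n`, given by its coefficients; it stands for the local functional
`∫ ∑_n ε^n h_n dx`. -/
abbrev Density (I : TopologicalSpace.Opens ℝ) : Type := ℕ → DiffPoly I

/-- `∫ h dx = O(ε^N)`: each coefficient of order less than `N` is a total `x`-derivative. -/
def VanishesMod (N : ℕ) (h : Density I) : Prop :=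
  ∀ n < N, ∃ r : DiffPoly I, dx r = h n

/-- Coefficients of a bracket
`{u(x), u(y)} = ∑_k ε^k ∑_{s ≤ k+1} A_{k,s}(u; u_x, …) δ^{(s)}(x-y)`, where `A k s` is taken at
the point `x`. -/
abbrev BracketCoeffs (I : TopologicalSpace.Opens ℝ) : Type := ℕ → ℕ → DiffPoly I

/-- The grading: `A_{k,s}` is homogeneous of degree `k + 1 - s`, so that there is no term with
`s > k + 1`. -/
def IsGraded (A : BracketCoeffs I) : Prop :=
  ∀ k s, (s ≤ k + 1 → IsHomog (A k s) (k + 1 - s)) ∧ (k + 1 < s → A k s = 0)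

/-- The differential operator `∑_s A_{k,s} ∂_x^s` given by the terms of order `k` of a bracket. -/
def applyOp (A : BracketCoeffs I) (k : ℕ) (h : DiffPoly I) : DiffPoly I :=
  ∑ s ∈ Finset.range (k + 2), A k s * dx^[s] h

/-- The density of the bracket `{F, G} = ∫ δF/δu(x) (∑ ε^k A_{k,s} ∂_x^s) δG/δu(x) dx` of two
local functionals: its coefficient of order `n` collects all `i + (k + j) = n`. -/
def bracket (A : BracketCoeffs I) (F G : Density I) : Density I := fun n =>
  ∑ a ∈ Finset.HasAntidiagonal.antidiagonal n, ∑ b ∈ Finset.HasAntidiagonal.antidiagonal a.2,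
    euler (F a.1) * applyOp A b.1 (euler (G b.2))

/-- Antisymmetry and the Jacobi identity, modulo `O(ε^N)`, for all local functionals. -/
def IsPoissonMod (N : ℕ) (A : BracketCoeffs I) : Prop :=
  (∀ F G : Density I, VanishesMod N (bracket A F G + bracket A G F)) ∧
  (∀ F G H : Density I, VanishesMod N
    (bracket A (bracket A F G) H + bracket A (bracket A G H) F + bracket A (bracket A H F) G))

/-- The bracket `{ , }_2 - lam { , }_1`. -/
def pencil (A₁ A₂ : BracketCoeffs I) (lam : ℝ) : BracketCoeffs I := fun k s =>
  A₂ k s - lam • A₁ k s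

/-! ## The Hamiltonians and the two brackets -/

/-- The density `h_f` of the perturbed Hamiltonian `H_f` with functional parameters
`c`, `p`, `s`. -/
def hamDensity (c p s f : SmoothFun I) : Density I
  | 0 => C f
  | 2 => -C ((1/24 : ℝ) • (c * D^[3] f)) * ux ^ 2
  | 4 =>
      C (p * D^[3] f + (1/480 : ℝ) • (c ^ 2 * D^[4] f)) * uxx ^ 2 -
      C ((1/1152 : ℝ) • (c * D^[2] c * D^[4] f) + (1/1152 : ℝ) • (c * D c * D^[5] f)
          + (1/3456 : ℝ) • (c ^ 2 * D^[6] f) + (1/6 : ℝ) • (D p * D^[4] f)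
          + (1/6 : ℝ) • (p * D^[5] f) - s * D^[3] f) * ux ^ 4
  | _ => 0

/-- The bracket `{u(x), u(y)}_1 = δ'(x-y)`. -/
def firstBracket : BracketCoeffs I
  | 0, 1 => 1
  | _, _ => 0

/-- The leading term `q(u) δ'(x-y) + ½ q'(u) u_x δ(x-y)` of the second bracket: the coefficient
of `δ^{(s)}(x-y)`. -/
def leadingTerm (q : SmoothFun I) : ℕ → DiffPoly I
  | 1 => C q
  | 0 => C ((1/2 : ℝ) • D q) * ux
  | _ => 0

/-- The terms of order `ε²` of the second bracket: the coefficient of `δ^{(s)}(x-y)`.  The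
arguments `ci` and `qi` stand for the `i`-th derivatives of `c(u)` and `q(u)`. -/
def orderTwoTerm (c c1 c2 q1 q2 q3 q4 : SmoothFun I) : ℕ → DiffPoly I
  | 3 =>
      C ((1/8 : ℝ) • (c * q1))
  | 2 =>
      C ((3/16 : ℝ) • (c1 * q1) + (3/16 : ℝ) • (c * q2)) * ux
  | 1 =>
      C ((1/16 : ℝ) • (c2 * q1) + (1/6 : ℝ) • (c1 * q2) + (5/48 : ℝ) • (c * q3)) * ux ^ 2 +
      C ((1/16 : ℝ) • (c1 * q1) + (7/48 : ℝ) • (c * q2)) * uxx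
  | 0 =>
      C ((1/48 : ℝ) • (c2 * q2) + (1/24 : ℝ) • (c1 * q3) + (1/48 : ℝ) • (c * q4)) * ux ^ 3 +
      C ((1/12 : ℝ) • (c1 * q2) + (1/12 : ℝ) • (c * q3)) * ux * uxx +
      C ((1/24 : ℝ) • (c * q2)) * uxxx
  | _ => 0

/-! The coefficients of the terms of order `ε⁴` of the second bracket.  The arguments `ci` and `qi`
stand for the `i`-th derivatives of `c(u)` and `q(u)`, and `r` stands for `1 / q'(u)`.  In the name
of a coefficient, the first digit is the order of the derivative of the delta function, and the
digits after the underscores list the derivatives of `u` in the monomial. -/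

/-- Coefficient of `ε⁴ δ^(5)(x-y)`. -/
def k5 (c c1 q1 q2 : SmoothFun I) : SmoothFun I :=
  (1/64 : ℝ) • (c * c1 * q1) + (1/192 : ℝ) • (c ^ 2 * q2)

/-- Coefficient of `ux * ε⁴ δ^(4)(x-y)`. -/
def k4_1 (c c1 c2 q1 q2 q3 : SmoothFun I) : SmoothFun I :=
  (5/128 : ℝ) • (c1 ^ 2 * q1) + (5/128 : ℝ) • (c * c2 * q1) + (25/384 : ℝ) • (c * c1 * q2)
    + (5/384 : ℝ) • (c ^ 2 * q3)

/-- Coefficient of `ux ^ 2 * ε⁴ δ^(3)(x-y)`. -/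
def k3_11 (c c1 c2 c3 q1 q2 q3 q4 r : SmoothFun I) : SmoothFun I :=
  (3/32 : ℝ) • (c1 * c2 * q1) + (1/32 : ℝ) • (c * c3 * q1) + (3/32 : ℝ) • (c1 ^ 2 * q2)
    + (5/48 : ℝ) • (c * c2 * q2) + (1/480 : ℝ) • (c ^ 2 * q2 ^ 3 * r ^ 2)
    + (19/192 : ℝ) • (c * c1 * q3) - (3/640 : ℝ) • (c ^ 2 * q2 * q3 * r)
    + (1/64 : ℝ) • (c ^ 2 * q4) - (1/240 : ℝ) • (c * c1 * q2 ^ 2 * r)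

/-- Coefficient of `uxx * ε⁴ δ^(3)(x-y)`. -/
def k3_2 (c c1 c2 q1 q2 q3 r : SmoothFun I) : SmoothFun I :=
  (3/64 : ℝ) • (c1 ^ 2 * q1) + (3/64 : ℝ) • (c * c2 * q1) + (17/192 : ℝ) • (c * c1 * q2)
    - (1/480 : ℝ) • (c ^ 2 * q2 ^ 2 * r) + (19/960 : ℝ) • (c ^ 2 * q3)

/-- Coefficient of `ux ^ 3 * ε⁴ δ^(2)(x-y)`. -/
def k2_111 (c c1 c2 c3 c4 q1 q2 q3 q4 q5 r : SmoothFun I) : SmoothFun I :=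
  (3/128 : ℝ) • (c2 ^ 2 * q1) + (1/32 : ℝ) • (c1 * c3 * q1) + (1/128 : ℝ) • (c * c4 * q1)
    + (19/128 : ℝ) • (c1 * c2 * q2) + (23/384 : ℝ) • (c * c3 * q2)
    + (5/64 : ℝ) • (c * c1 * q4) + (7/64 : ℝ) • (c * c2 * q3) + (1/96 : ℝ) • (c ^ 2 * q5)
    + (3/32 : ℝ) • (c1 ^ 2 * q3) - (1/160 : ℝ) • (c1 ^ 2 * q2 ^ 2 * r)
    - (1/160 : ℝ) • (c * c2 * q2 ^ 2 * r) + (1/80 : ℝ) • (c * c1 * q2 ^ 3 * r ^ 2)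
    - (1/160 : ℝ) • (c ^ 2 * q2 ^ 4 * r ^ 3) - (17/640 : ℝ) • (c * c1 * q2 * q3 * r)
    + (21/1280 : ℝ) • (c ^ 2 * q2 ^ 2 * q3 * r ^ 2) - (9/1280 : ℝ) • (c ^ 2 * q3 ^ 2 * r)
    - (9/1280 : ℝ) • (c ^ 2 * q2 * q4 * r)

/-- Coefficient of `ux * uxx * ε⁴ δ^(2)(x-y)`. -/
def k2_1_2 (c c1 c2 c3 q1 q2 q3 q4 r : SmoothFun I) : SmoothFun I :=
  (9/64 : ℝ) • (c1 * c2 * q1) + (3/64 : ℝ) • (c * c3 * q1) + (11/64 : ℝ) • (c1 ^ 2 * q2)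
    + (13/64 : ℝ) • (c * c2 * q2) - (3/160 : ℝ) • (c * c1 * q2 ^ 2 * r)
    + (3/320 : ℝ) • (c ^ 2 * q2 ^ 3 * r ^ 2) + (69/320 : ℝ) • (c * c1 * q3)
    - (13/640 : ℝ) • (c ^ 2 * q2 * q3 * r) + (3/80 : ℝ) • (c ^ 2 * q4)

/-- Coefficient of `uxxx * ε⁴ δ^(2)(x-y)`. -/
def k2_3 (c c1 c2 q1 q2 q3 r : SmoothFun I) : SmoothFun I :=
  (1/32 : ℝ) • (c1 ^ 2 * q1) + (1/32 : ℝ) • (c * c2 * q1) + (13/192 : ℝ) • (c * c1 * q2)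
    - (1/320 : ℝ) • (c ^ 2 * q2 ^ 2 * r) + (1/60 : ℝ) • (c ^ 2 * q3)

/-- Coefficient of `ux ^ 4 * ε⁴ δ^(1)(x-y)`. -/
def k1_1111 (c c1 c2 c3 c4 q2 q3 q4 q5 q6 r : SmoothFun I) : SmoothFun I :=
  (1/48 : ℝ) • (c2 ^ 2 * q2) + (1/32 : ℝ) • (c1 * c3 * q2) + (1/96 : ℝ) • (c * c4 * q2)
    - (1/160 : ℝ) • (c1 * c2 * q2 ^ 2 * r) - (1/480 : ℝ) • (c * c3 * q2 ^ 2 * r)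
    + (1/160 : ℝ) • (c1 ^ 2 * q2 ^ 3 * r ^ 2) + (1/160 : ℝ) • (c * c2 * q2 ^ 3 * r ^ 2)
    - (1/80 : ℝ) • (c * c1 * q2 ^ 4 * r ^ 3) + (1/160 : ℝ) • (c ^ 2 * q2 ^ 5 * r ^ 4)
    + (35/384 : ℝ) • (c1 * c2 * q3) + (5/128 : ℝ) • (c * c3 * q3)
    - (9/640 : ℝ) • (c1 ^ 2 * q2 * q3 * r) - (9/640 : ℝ) • (c * c2 * q2 * q3 * r)
    + (11/320 : ℝ) • (c * c1 * q2 ^ 2 * q3 * r ^ 2)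
    - (13/640 : ℝ) • (c ^ 2 * q2 ^ 3 * q3 * r ^ 3) - (1/64 : ℝ) • (c * c1 * q3 ^ 2 * r)
    + (19/1280 : ℝ) • (c ^ 2 * q2 * q3 ^ 2 * r ^ 2) + (17/384 : ℝ) • (c1 ^ 2 * q4)
    + (5/96 : ℝ) • (c * c2 * q4) - (1/64 : ℝ) • (c * c1 * q2 * q4 * r)
    + (17/1920 : ℝ) • (c ^ 2 * q2 ^ 2 * q4 * r ^ 2) - (11/1280 : ℝ) • (c ^ 2 * q3 * q4 * r)
    + (35/1152 : ℝ) • (c * c1 * q5) - (11/3840 : ℝ) • (c ^ 2 * q2 * q5 * r)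
    + (1/288 : ℝ) • (c ^ 2 * q6)

/-- Coefficient of `ux ^ 2 * uxx * ε⁴ δ^(1)(x-y)`. -/
def k1_11_2 (c c1 c2 c3 c4 q1 q2 q3 q4 q5 r : SmoothFun I) : SmoothFun I :=
  (3/128 : ℝ) • (c2 ^ 2 * q1) + (1/32 : ℝ) • (c1 * c3 * q1) + (1/128 : ℝ) • (c * c4 * q1)
    + (91/384 : ℝ) • (c1 * c2 * q2) + (37/384 : ℝ) • (c * c3 * q2)
    - (1/60 : ℝ) • (c1 ^ 2 * q2 ^ 2 * r) - (1/60 : ℝ) • (c * c2 * q2 ^ 2 * r)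
    + (1/30 : ℝ) • (c * c1 * q2 ^ 3 * r ^ 2) - (1/60 : ℝ) • (c ^ 2 * q2 ^ 4 * r ^ 3)
    + (59/320 : ℝ) • (c1 ^ 2 * q3) + (53/240 : ℝ) • (c * c2 * q3)
    - (47/640 : ℝ) • (c * c1 * q2 * q3 * r) + (173/3840 : ℝ) • (c ^ 2 * q2 ^ 2 * q3 * r ^ 2)
    - (77/3840 : ℝ) • (c ^ 2 * q3 ^ 2 * r) + (169/960 : ℝ) • (c * c1 * q4)
    - (77/3840 : ℝ) • (c ^ 2 * q2 * q4 * r) + (73/2880 : ℝ) • (c ^ 2 * q5)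

/-- Coefficient of `uxx ^ 2 * ε⁴ δ^(1)(x-y)`. -/
def k1_22 (c c1 c2 c3 q1 q2 q3 q4 r : SmoothFun I) : SmoothFun I :=
  (3/128 : ℝ) • (c1 * c2 * q1) + (1/128 : ℝ) • (c * c3 * q1) + (5/96 : ℝ) • (c1 ^ 2 * q2)
    + (1/16 : ℝ) • (c * c2 * q2) - (1/80 : ℝ) • (c * c1 * q2 ^ 2 * r)
    + (1/160 : ℝ) • (c ^ 2 * q2 ^ 3 * r ^ 2) + (157/1920 : ℝ) • (c * c1 * q3)
    - (5/384 : ℝ) • (c ^ 2 * q2 * q3 * r) + (31/1920 : ℝ) • (c ^ 2 * q4)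

/-- Coefficient of `ux * uxxx * ε⁴ δ^(1)(x-y)`. -/
def k1_1_3 (c c1 c2 c3 q1 q2 q3 q4 r : SmoothFun I) : SmoothFun I :=
  (3/64 : ℝ) • (c1 * c2 * q1) + (1/64 : ℝ) • (c * c3 * q1) + (1/12 : ℝ) • (c1 ^ 2 * q2)
    + (3/32 : ℝ) • (c * c2 * q2) - (1/60 : ℝ) • (c * c1 * q2 ^ 2 * r)
    + (1/120 : ℝ) • (c ^ 2 * q2 ^ 3 * r ^ 2) + (19/160 : ℝ) • (c * c1 * q3)
    - (11/640 : ℝ) • (c ^ 2 * q2 * q3 * r) + (11/480 : ℝ) • (c ^ 2 * q4)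

/-- Coefficient of `uxxxx * ε⁴ δ^(1)(x-y)`. -/
def k1_4 (c c1 c2 q1 q2 q3 r : SmoothFun I) : SmoothFun I :=
  (1/128 : ℝ) • (c1 ^ 2 * q1) + (1/128 : ℝ) • (c * c2 * q1) + (11/384 : ℝ) • (c * c1 * q2)
    - (1/320 : ℝ) • (c ^ 2 * q2 ^ 2 * r) + (17/1920 : ℝ) • (c ^ 2 * q3)

/-- Coefficient of `ux ^ 5 * ε⁴ δ^(0)(x-y)`. -/
def k0_11111 (c c1 c2 c3 c4 q2 q3 q4 q5 q6 q7 r : SmoothFun I) : SmoothFun I :=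
  (1/192 : ℝ) • (c2 ^ 2 * q3) + (1/128 : ℝ) • (c1 * c3 * q3) + (1/384 : ℝ) • (c * c4 * q3)
    - (1/640 : ℝ) • (c1 * c2 * q2 * q3 * r) - (1/1920 : ℝ) • (c * c3 * q2 * q3 * r)
    + (1/640 : ℝ) • (c1 ^ 2 * q2 ^ 2 * q3 * r ^ 2)
    + (1/640 : ℝ) • (c * c2 * q2 ^ 2 * q3 * r ^ 2)
    - (1/320 : ℝ) • (c * c1 * q2 ^ 3 * q3 * r ^ 3)
    + (1/640 : ℝ) • (c ^ 2 * q2 ^ 4 * q3 * r ^ 4) - (1/640 : ℝ) • (c1 ^ 2 * q3 ^ 2 * r)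
    - (1/640 : ℝ) • (c * c2 * q3 ^ 2 * r) + (3/640 : ℝ) • (c * c1 * q2 * q3 ^ 2 * r ^ 2)
    - (1/320 : ℝ) • (c ^ 2 * q2 ^ 2 * q3 ^ 2 * r ^ 3)
    + (1/1280 : ℝ) • (c ^ 2 * q3 ^ 3 * r ^ 2) + (7/384 : ℝ) • (c1 * c2 * q4)
    + (1/128 : ℝ) • (c * c3 * q4) - (1/640 : ℝ) • (c1 ^ 2 * q2 * q4 * r)
    - (1/640 : ℝ) • (c * c2 * q2 * q4 * r) + (1/320 : ℝ) • (c * c1 * q2 ^ 2 * q4 * r ^ 2)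
    - (1/640 : ℝ) • (c ^ 2 * q2 ^ 3 * q4 * r ^ 3) - (3/640 : ℝ) • (c * c1 * q3 * q4 * r)
    + (13/3840 : ℝ) • (c ^ 2 * q2 * q3 * q4 * r ^ 2) - (1/1280 : ℝ) • (c ^ 2 * q4 ^ 2 * r)
    + (17/2304 : ℝ) • (c1 ^ 2 * q5) + (5/576 : ℝ) • (c * c2 * q5)
    - (1/640 : ℝ) • (c * c1 * q2 * q5 * r) + (1/1280 : ℝ) • (c ^ 2 * q2 ^ 2 * q5 * r ^ 2)
    - (1/960 : ℝ) • (c ^ 2 * q3 * q5 * r) + (5/1152 : ℝ) • (c * c1 * q6)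
    - (1/3840 : ℝ) • (c ^ 2 * q2 * q6 * r) + (1/2304 : ℝ) • (c ^ 2 * q7)

/-- Coefficient of `ux ^ 3 * uxx * ε⁴ δ^(0)(x-y)`. -/
def k0_111_2 (c c1 c2 c3 c4 q2 q3 q4 q5 q6 r : SmoothFun I) : SmoothFun I :=
  (1/64 : ℝ) • (c2 ^ 2 * q2) + (1/48 : ℝ) • (c1 * c3 * q2) + (1/192 : ℝ) • (c * c4 * q2)
    - (1/160 : ℝ) • (c1 * c2 * q2 ^ 2 * r) - (1/480 : ℝ) • (c * c3 * q2 ^ 2 * r)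
    + (1/160 : ℝ) • (c1 ^ 2 * q2 ^ 3 * r ^ 2) + (1/160 : ℝ) • (c * c2 * q2 ^ 3 * r ^ 2)
    - (1/80 : ℝ) • (c * c1 * q2 ^ 4 * r ^ 3) + (1/160 : ℝ) • (c ^ 2 * q2 ^ 5 * r ^ 4)
    + (97/960 : ℝ) • (c1 * c2 * q3) + (13/320 : ℝ) • (c * c3 * q3)
    - (1/60 : ℝ) • (c1 ^ 2 * q2 * q3 * r) - (1/60 : ℝ) • (c * c2 * q2 * q3 * r)
    + (19/480 : ℝ) • (c * c1 * q2 ^ 2 * q3 * r ^ 2)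
    - (11/480 : ℝ) • (c ^ 2 * q2 ^ 3 * q3 * r ^ 3) - (1/48 : ℝ) • (c * c1 * q3 ^ 2 * r)
    + (3/160 : ℝ) • (c ^ 2 * q2 * q3 ^ 2 * r ^ 2) + (19/320 : ℝ) • (c1 ^ 2 * q4)
    + (67/960 : ℝ) • (c * c2 * q4) - (1/48 : ℝ) • (c * c1 * q2 * q4 * r)
    + (11/960 : ℝ) • (c ^ 2 * q2 ^ 2 * q4 * r ^ 2) - (1/80 : ℝ) • (c ^ 2 * q3 * q4 * r)
    + (131/2880 : ℝ) • (c * c1 * q5) - (1/240 : ℝ) • (c ^ 2 * q2 * q5 * r)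
    + (1/180 : ℝ) • (c ^ 2 * q6)

/-- Coefficient of `ux * uxx ^ 2 * ε⁴ δ^(0)(x-y)`. -/
def k0_1_22 (c c1 c2 c3 q2 q3 q4 q5 r : SmoothFun I) : SmoothFun I :=
  (7/128 : ℝ) • (c1 * c2 * q2) + (7/384 : ℝ) • (c * c3 * q2)
    - (7/960 : ℝ) • (c1 ^ 2 * q2 ^ 2 * r) - (7/960 : ℝ) • (c * c2 * q2 ^ 2 * r)
    + (7/480 : ℝ) • (c * c1 * q2 ^ 3 * r ^ 2) - (7/960 : ℝ) • (c ^ 2 * q2 ^ 4 * r ^ 3)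
    + (59/960 : ℝ) • (c1 ^ 2 * q3) + (23/320 : ℝ) • (c * c2 * q3)
    - (1/30 : ℝ) • (c * c1 * q2 * q3 * r) + (13/640 : ℝ) • (c ^ 2 * q2 ^ 2 * q3 * r ^ 2)
    - (3/320 : ℝ) • (c ^ 2 * q3 ^ 2 * r) + (131/1920 : ℝ) • (c * c1 * q4)
    - (3/320 : ℝ) • (c ^ 2 * q2 * q4 * r) + (31/2880 : ℝ) • (c ^ 2 * q5)

/-- Coefficient of `ux ^ 2 * uxxx * ε⁴ δ^(0)(x-y)`. -/
def k0_11_3 (c c1 c2 c3 q2 q3 q4 q5 r : SmoothFun I) : SmoothFun I :=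
  (3/64 : ℝ) • (c1 * c2 * q2) + (1/64 : ℝ) • (c * c3 * q2)
    - (1/160 : ℝ) • (c1 ^ 2 * q2 ^ 2 * r) - (1/160 : ℝ) • (c * c2 * q2 ^ 2 * r)
    + (1/80 : ℝ) • (c * c1 * q2 ^ 3 * r ^ 2) - (1/160 : ℝ) • (c ^ 2 * q2 ^ 4 * r ^ 3)
    + (47/960 : ℝ) • (c1 ^ 2 * q3) + (13/240 : ℝ) • (c * c2 * q3)
    - (13/480 : ℝ) • (c * c1 * q2 * q3 * r) + (1/60 : ℝ) • (c ^ 2 * q2 ^ 2 * q3 * r ^ 2)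
    - (7/960 : ℝ) • (c ^ 2 * q3 ^ 2 * r) + (49/960 : ℝ) • (c * c1 * q4)
    - (7/960 : ℝ) • (c ^ 2 * q2 * q4 * r) + (23/2880 : ℝ) • (c ^ 2 * q5)

/-- Coefficient of `uxx * uxxx * ε⁴ δ^(0)(x-y)`. -/
def k0_2_3 (c c1 c2 q2 q3 q4 r : SmoothFun I) : SmoothFun I :=
  (5/192 : ℝ) • (c1 ^ 2 * q2) + (5/192 : ℝ) • (c * c2 * q2)
    - (1/96 : ℝ) • (c * c1 * q2 ^ 2 * r) + (1/192 : ℝ) • (c ^ 2 * q2 ^ 3 * r ^ 2)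
    + (3/64 : ℝ) • (c * c1 * q3) - (1/96 : ℝ) • (c ^ 2 * q2 * q3 * r)
    + (1/96 : ℝ) • (c ^ 2 * q4)

/-- Coefficient of `ux * uxxxx * ε⁴ δ^(0)(x-y)`. -/
def k0_1_4 (c c1 c2 q2 q3 q4 r : SmoothFun I) : SmoothFun I :=
  (1/64 : ℝ) • (c1 ^ 2 * q2) + (1/64 : ℝ) • (c * c2 * q2)
    - (1/160 : ℝ) • (c * c1 * q2 ^ 2 * r) + (1/320 : ℝ) • (c ^ 2 * q2 ^ 3 * r ^ 2)
    + (9/320 : ℝ) • (c * c1 * q3) - (1/160 : ℝ) • (c ^ 2 * q2 * q3 * r)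
    + (1/160 : ℝ) • (c ^ 2 * q4)

/-- Coefficient of `uxxxxx * ε⁴ δ^(0)(x-y)`. -/
def k0_5 (c c1 q2 q3 r : SmoothFun I) : SmoothFun I :=
  (1/192 : ℝ) • (c * c1 * q2) - (1/960 : ℝ) • (c ^ 2 * q2 ^ 2 * r)
    + (1/480 : ℝ) • (c ^ 2 * q3)

/-- The terms of order `ε⁴` of the second bracket: the coefficient of `δ^{(s)}(x-y)`.  The
arguments `ci` and `qi` stand for the `i`-th derivatives of `c(u)` and `q(u)`, and `r` stands for
`1 / q'(u)`. -/
def orderFourTerm (c c1 c2 c3 c4 q1 q2 q3 q4 q5 q6 q7 r : SmoothFun I) : ℕ → DiffPoly I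
  | 5 =>
      C (k5 c c1 q1 q2)
  | 4 =>
      C (k4_1 c c1 c2 q1 q2 q3) * ux
  | 3 =>
      C (k3_11 c c1 c2 c3 q1 q2 q3 q4 r) * ux ^ 2 +
      C (k3_2 c c1 c2 q1 q2 q3 r) * uxx
  | 2 =>
      C (k2_111 c c1 c2 c3 c4 q1 q2 q3 q4 q5 r) * ux ^ 3 +
      C (k2_1_2 c c1 c2 c3 q1 q2 q3 q4 r) * ux * uxx +
      C (k2_3 c c1 c2 q1 q2 q3 r) * uxxx
  | 1 =>
      C (k1_1111 c c1 c2 c3 c4 q2 q3 q4 q5 q6 r) * ux ^ 4 +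
      C (k1_11_2 c c1 c2 c3 c4 q1 q2 q3 q4 q5 r) * ux ^ 2 * uxx +
      C (k1_22 c c1 c2 c3 q1 q2 q3 q4 r) * uxx ^ 2 +
      C (k1_1_3 c c1 c2 c3 q1 q2 q3 q4 r) * ux * uxxx +
      C (k1_4 c c1 c2 q1 q2 q3 r) * uxxxx
  | 0 =>
      C (k0_11111 c c1 c2 c3 c4 q2 q3 q4 q5 q6 q7 r) * ux ^ 5 +
      C (k0_111_2 c c1 c2 c3 c4 q2 q3 q4 q5 q6 r) * ux ^ 3 * uxx +
      C (k0_1_22 c c1 c2 c3 q2 q3 q4 q5 r) * ux * uxx ^ 2 +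
      C (k0_11_3 c c1 c2 c3 q2 q3 q4 q5 r) * ux ^ 2 * uxxx +
      C (k0_2_3 c c1 c2 q2 q3 q4 r) * uxx * uxxx +
      C (k0_1_4 c c1 c2 q2 q3 q4 r) * ux * uxxxx +
      C (k0_5 c c1 q2 q3 r) * uxxxxx
  | _ => 0

/-- The second bracket, through the order `ε⁴`. -/
def secondBracket (c q : SmoothFun I) (hq : ∀ x, (D q).1 x ≠ 0) : BracketCoeffs I
  | 0 => leadingTerm q
  | 2 => orderTwoTerm c (D c) (D^[2] c) (D q) (D^[2] q) (D^[3] q) (D^[4] q)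
  | 4 => orderFourTerm c (D c) (D^[2] c) (D^[3] c) (D^[4] c) (D q) (D^[2] q) (D^[3] q) (D^[4] q)
      (D^[5] q) (D^[6] q) (D^[7] q) (recip (D q) hq)
  | _ => 0

end FormalVar
end

/-!
Over an algebra `S` with a derivation `δ`, differential polynomials form a differential algebra and
`{F, G}_P = ∫ δF P δG dx` makes sense for every differential operator `P`.  Two principles reduce
statements about all local functionals to functions of `u`.

* A homogeneous differential polynomial `W` of degree at least `2` with `∫ f(u) W dx = 0` for all
  functions `f` of `u` vanishes: testing on the powers of `u - a` and taking the Euler operator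
  isolates the coefficients of `W`.
* The brackets of a graded deformation are recovered, order by order, from the variational
  derivatives of functions of `u`, which exhaust all functions of `u` as `δ` is onto.

A graded bracket with skew-symmetric leading term for which the `H_f` commute is therefore unique,
and its antisymmetry and Jacobi identity come for free: by induction on the order, both defects are
homogeneous of degree at least `2` and vanish on the `H_f`.

Commutativity for the first bracket is an exactness question in degrees `1`, `3` and `5`.  The
second bracket is reduced to the first by the bihamiltonian recursion `P₂ δH_g = P₁ δH_t`, with `t`
determined by `t'' = q g'' + q' g' / 2`.  At order `ε⁴` both sides are linear in `q'`: with
`w = q'' / q'` and `q^{(k+1)} = q' · (∂ + w)^k 1`, the factor `q'` splits off and the denominators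
disappear.
-/

noncomputable section

namespace FormalVar

open MvPolynomial Finset.HasAntidiagonal

/-! ## Differential polynomials over a differential algebra -/

section Jets

variable {R S : Type*} [CommRing R] [CommRing S] [Algebra R S]

/-- Differential polynomials in an unknown `u` over the algebra `S` of functions of `u`: the
variable `X k` stands for `u^{(k+1)}`, and a derivation of `S` plays the role of `d/du`. -/
abbrev JetPoly (S : Type*) [CommRing S] : Type _ := MvPolynomial ℕ S

lemma coeff_sum_support_monomial {σ A : Type*} [CommSemiring A] (φ : A →+ A)
    (h : MvPolynomial σ A) (m : σ →₀ ℕ) :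
    coeff m (∑ n ∈ h.support, monomial n (φ (coeff n h))) = φ (coeff m h) := by
  classical
  simp only [coeff_sum, coeff_monomial, Finset.sum_ite_eq', mem_support_iff, ne_eq, ite_not]
  split_ifs with hm
  · rw [hm, map_zero]
  · rfl

lemma mkDerivation_eq_sum {σ A : Type*} [CommRing A] (Q : σ → MvPolynomial σ A)
    (h : MvPolynomial σ A) {T : Finset σ} (hT : h.vars ⊆ T) :
    mkDerivation A Q h = ∑ k ∈ T, Q k * pderiv k h := by
  classical
  have sum_apply (p : MvPolynomial σ A) :
      (∑ k ∈ T, Q k • pderiv k : Derivation A _ _) p = ∑ k ∈ T, Q k * pderiv k p :=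
    (congrFun (map_sum Derivation.coeFnAddMonoidHom (fun k => Q k • pderiv k) T) p).trans
      (Finset.sum_apply ..)
  rw [← sum_apply]
  refine derivation_eq_of_forall_mem_vars fun i hi => ?_
  rw [mkDerivation_X, sum_apply, Finset.sum_eq_single_of_mem i (hT hi) fun k _ hk => by
    rw [pderiv_X_of_ne hk.symm, mul_zero], pderiv_X_self, mul_one]

lemma derivation_ext_of_C_X {σ : Type*} [Algebra R (MvPolynomial σ S)]
    {d e : Derivation R (MvPolynomial σ S) (MvPolynomial σ S)}
    (hC : ∀ f, d (C f) = e (C f)) (hX : ∀ k, d (X k) = e (X k)) : d = e := by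
  ext1 p
  induction p using MvPolynomial.induction_on with
  | C a => exact hC a
  | add p q hp hq => rw [map_add, map_add, hp, hq]
  | mul_X p n hp => rw [Derivation.leibniz, Derivation.leibniz, hp, hX]

/-- A strict upper bound for the orders `k` of the derivatives `u^{(k)}` on which `h` depends.  It
is positive, since the coefficients of `h` always depend on `u`. -/
def jetOrder (h : JetPoly S) : ℕ := h.vars.sup (· + 1) + 1

lemma vars_subset_range {h : JetPoly S} {N : ℕ} (hN : jetOrder h ≤ N + 1) :
    h.vars ⊆ Finset.range N := by
  intro k hk
  have := Finset.le_sup (f := (· + 1)) hk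
  simp only [jetOrder] at hN
  rw [Finset.mem_range]
  omega

variable (δ : Derivation R S S)

/-- The partial derivative `∂/∂u`, which applies `δ` to the coefficients. -/
def coeffDerivation : Derivation R (JetPoly S) (JetPoly S) :=
  have coeff_eq (h : JetPoly S) (m : ℕ →₀ ℕ) :
      coeff m (∑ n ∈ h.support, monomial n (δ (coeff n h))) = δ (coeff m h) :=
    coeff_sum_support_monomial (δ : S →ₗ[R] S).toAddMonoidHom h m
  Derivation.mk'
    { toFun h := ∑ m ∈ h.support, monomial m (δ (coeff m h))
      map_add' p q := by ext1 m; rw [coeff_eq, coeff_add, coeff_add, coeff_eq, coeff_eq, map_add]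
      map_smul' a p := by
        ext1 m
        rw [coeff_eq, coeff_smul, RingHom.id_apply, coeff_smul, coeff_eq, Derivation.map_smul] }
    fun p q => by
      classical
      ext1 m
      simp only [LinearMap.coe_mk, AddHom.coe_mk, smul_eq_mul]
      rw [mul_comm q, coeff_add, coeff_mul, coeff_mul, coeff_eq, coeff_mul, map_sum,
        ← Finset.sum_add_distrib]
      refine Finset.sum_congr rfl fun n _ => ?_
      rw [Derivation.leibniz, coeff_eq, coeff_eq, smul_eq_mul, smul_eq_mul, mul_comm (δ _)]

lemma coeff_coeffDerivation (h : JetPoly S) (m : ℕ →₀ ℕ) :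
    coeff m (coeffDerivation δ h) = δ (coeff m h) :=
  coeff_sum_support_monomial (δ : S →ₗ[R] S).toAddMonoidHom h m

@[simp] lemma coeffDerivation_C (f : S) : coeffDerivation δ (C f) = C (δ f) := by
  ext1 m
  classical
  rw [coeff_coeffDerivation, coeff_C, coeff_C]
  split_ifs <;> simp

@[simp] lemma coeffDerivation_X (k : ℕ) : coeffDerivation δ (X k) = 0 := by
  ext1 m
  classical
  rw [coeff_coeffDerivation, coeff_X, coeff_zero]
  split_ifs <;> simp

/-- The derivation of differential polynomials that extends `δ` and takes `u^{(k)}` to `Q k`. -/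
def jetDerivation (Q : ℕ → JetPoly S) : Derivation R (JetPoly S) (JetPoly S) :=
  Q 0 • coeffDerivation δ + (mkDerivation S fun k => Q (k + 1)).restrictScalars R

lemma jetDerivation_apply (Q : ℕ → JetPoly S) (h : JetPoly S) :
    jetDerivation δ Q h = Q 0 * coeffDerivation δ h + mkDerivation S (fun k => Q (k + 1)) h := rfl

@[simp] lemma jetDerivation_C (Q : ℕ → JetPoly S) (f : S) :
    jetDerivation δ Q (C f) = Q 0 * C (δ f) := by
  simp [jetDerivation_apply]

@[simp] lemma jetDerivation_X (Q : ℕ → JetPoly S) (k : ℕ) :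
    jetDerivation δ Q (X k) = Q (k + 1) := by
  simp [jetDerivation_apply]

/-- The partial derivative `∂/∂u^{(k)}`, where `u^{(0)} = u`. -/
def jetPartial : ℕ → Derivation R (JetPoly S) (JetPoly S)
  | 0 => coeffDerivation δ
  | k + 1 => (pderiv k).restrictScalars R

lemma jetPartial_zero : jetPartial δ 0 = coeffDerivation δ := rfl

lemma jetPartial_succ_apply (k : ℕ) (h : JetPoly S) : jetPartial δ (k + 1) h = pderiv k h := rfl

variable {δ} in
lemma jetPartial_eq_zero_of_jetOrder_le {h : JetPoly S} {k : ℕ} (hk : jetOrder h ≤ k) :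
    jetPartial δ k h = 0 := by
  obtain _ | k := k
  · simp [jetOrder] at hk
  · exact pderiv_eq_zero_of_notMem_vars fun hm => by simpa using vars_subset_range hk hm

lemma jetDerivation_eq_sum (Q : ℕ → JetPoly S) (h : JetPoly S) {N : ℕ} (hN : jetOrder h ≤ N) :
    jetDerivation δ Q h = ∑ k ∈ Finset.range N, Q k * jetPartial δ k h := by
  obtain _ | N := N
  · simp [jetOrder] at hN
  · rw [Finset.sum_range_succ', jetDerivation_apply,
      mkDerivation_eq_sum _ _ (vars_subset_range hN), add_comm]
    rfl

/-- The total derivative `∂_x`, for which `∂_x u^{(k)} = u^{(k+1)}`. -/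
def totalDeriv : Derivation R (JetPoly S) (JetPoly S) := jetDerivation δ X

lemma totalDeriv_apply (h : JetPoly S) :
    totalDeriv δ h = X 0 * coeffDerivation δ h + ∑ k ∈ h.vars, X (k + 1) * pderiv k h := by
  rw [totalDeriv, jetDerivation_apply, mkDerivation_eq_sum _ _ subset_rfl]

@[simp] lemma totalDeriv_C (f : S) : totalDeriv δ (C f) = X 0 * C (δ f) := jetDerivation_C ..
@[simp] lemma totalDeriv_X (k : ℕ) : totalDeriv δ (X k) = X (k + 1) := jetDerivation_X ..

/-- The power `∂_x^k` as a linear map. -/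
def totalPow (k : ℕ) : JetPoly S →ₗ[R] JetPoly S :=
  (totalDeriv δ : JetPoly S →ₗ[R] JetPoly S) ^ k

lemma totalPow_apply (k : ℕ) (h : JetPoly S) : totalPow δ k h = (totalDeriv δ)^[k] h :=
  Module.End.pow_apply ..

@[simp] lemma totalPow_zero (h : JetPoly S) : totalPow δ 0 h = h := rfl

lemma totalPow_succ (k : ℕ) (h : JetPoly S) :
    totalPow δ (k + 1) h = totalDeriv δ (totalPow δ k h) := by
  rw [totalPow_apply, totalPow_apply, Function.iterate_succ_apply']

lemma totalPow_totalDeriv (k : ℕ) (h : JetPoly S) :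
    totalPow δ k (totalDeriv δ h) = totalPow δ (k + 1) h := by
  rw [totalPow_apply, totalPow_apply, Function.iterate_succ_apply]

/-- The Euler-Lagrange operator `∑_k (-∂_x)^k ∂/∂u^{(k)}`. -/
def jetEuler (h : JetPoly S) : JetPoly S :=
  ∑ k ∈ Finset.range (jetOrder h), (-1) ^ k * totalPow δ k (jetPartial δ k h)

lemma jetEuler_eq_sum (h : JetPoly S) {N : ℕ} (hN : jetOrder h ≤ N) :
    jetEuler δ h = ∑ k ∈ Finset.range N, (-1) ^ k * totalPow δ k (jetPartial δ k h) := by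
  refine Finset.sum_subset (Finset.range_subset_range.2 hN) fun k _ hk => ?_
  rw [jetPartial_eq_zero_of_jetOrder_le (by simpa using hk), map_zero, mul_zero]

lemma jetEuler_eq_sum_vars (h : JetPoly S) :
    jetEuler δ h = coeffDerivation δ h +
      ∑ k ∈ h.vars, (-1) ^ (k + 1) * totalPow δ (k + 1) (pderiv k h) := by
  rw [jetEuler, jetOrder, Finset.sum_range_succ', add_comm]
  congr 1
  · simp only [pow_zero, totalPow_zero, one_mul, jetPartial_zero]
  · refine (Finset.sum_subset (vars_subset_range le_rfl) fun k _ hk => ?_).symm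
    rw [jetPartial_succ_apply, pderiv_eq_zero_of_notMem_vars hk, map_zero, mul_zero]

lemma jetEuler_add (a b : JetPoly S) : jetEuler δ (a + b) = jetEuler δ a + jetEuler δ b := by
  obtain ⟨N, hN⟩ : ∃ N, max (max (jetOrder a) (jetOrder b)) (jetOrder (a + b)) = N := ⟨_, rfl⟩
  rw [jetEuler_eq_sum δ (N := N) (a + b) (by omega), jetEuler_eq_sum δ (N := N) a (by omega),
    jetEuler_eq_sum δ (N := N) b (by omega), ← Finset.sum_add_distrib]
  simp only [map_add, mul_add]

lemma jetPartial_zero_totalDeriv (h : JetPoly S) :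
    jetPartial δ 0 (totalDeriv δ h) = totalDeriv δ (jetPartial δ 0 h) := by
  have commute : ⁅jetPartial δ 0, totalDeriv δ⁆ = 0 :=
    derivation_ext_of_C_X (fun f => by simp [Derivation.commutator_apply, jetPartial])
      fun k => by simp [Derivation.commutator_apply, jetPartial]
  simpa [Derivation.commutator_apply, sub_eq_zero] using DFunLike.congr_fun commute h

lemma jetPartial_succ_totalDeriv (k : ℕ) (h : JetPoly S) :
    jetPartial δ (k + 1) (totalDeriv δ h) =
      totalDeriv δ (jetPartial δ (k + 1) h) + jetPartial δ k h := by
  have commutator : ⁅jetPartial δ (k + 1), totalDeriv δ⁆ = jetPartial δ k := by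
    classical
    refine derivation_ext_of_C_X (fun f => ?_) fun l => ?_ <;> obtain _ | k := k
    · simp [Derivation.commutator_apply, jetPartial]
    · simp [Derivation.commutator_apply, jetPartial]
    · simp [Derivation.commutator_apply, jetPartial, pderiv_X, Pi.single_apply, apply_ite]
    · simp only [jetPartial, Derivation.commutator_apply, totalDeriv_X,
        Derivation.restrictScalars_apply, pderiv_X, Pi.single_apply, Nat.add_right_cancel_iff,
        apply_ite, Derivation.map_one_eq_zero, map_zero, ite_self, sub_zero]
      split_ifs <;> simp_all
  simpa [Derivation.commutator_apply, sub_eq_iff_eq_add'] using DFunLike.congr_fun commutator h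

lemma jetEuler_totalDeriv (h : JetPoly S) : jetEuler δ (totalDeriv δ h) = 0 := by
  have telescope (M : ℕ) : ∑ k ∈ Finset.range (M + 1), (-1) ^ k *
      totalPow δ k (jetPartial δ k (totalDeriv δ h)) =
      (-1) ^ M * totalPow δ (M + 1) (jetPartial δ M h) := by
    induction M with
    | zero => simp [jetPartial_zero_totalDeriv, totalPow_succ]
    | succ M ih =>
      rw [Finset.sum_range_succ, ih, jetPartial_succ_totalDeriv, map_add, totalPow_totalDeriv]
      ring
  obtain ⟨N, hN⟩ : ∃ N, max (jetOrder h) (jetOrder (totalDeriv δ h)) = N := ⟨_, rfl⟩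
  rw [jetEuler_eq_sum δ (N := N + 1) _ (by omega), telescope,
    jetPartial_eq_zero_of_jetOrder_le (by omega), map_zero, mul_zero]

@[simp] lemma jetEuler_zero : jetEuler δ 0 = 0 := by
  simpa using jetEuler_add δ 0 0

@[simp] lemma jetEuler_C (f : S) : jetEuler δ (C f) = C (δ f) := by
  simp [jetEuler_eq_sum_vars]

lemma jetEuler_sum {ι : Type*} (T : Finset ι) (h : ι → JetPoly S) :
    jetEuler δ (∑ i ∈ T, h i) = ∑ i ∈ T, jetEuler δ (h i) :=
  map_sum (⟨⟨jetEuler δ, jetEuler_zero δ⟩, jetEuler_add δ⟩ : JetPoly S →+ JetPoly S) h T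

/-! ## Local functionals and evolutionary derivations -/

/-- Local functionals: densities modulo total derivatives. -/
abbrev LocalFunctional : Type _ :=
  JetPoly S ⧸ LinearMap.range (totalDeriv δ : JetPoly S →ₗ[R] JetPoly S)

/-- The local functional `∫ h dx`. -/
def intx : JetPoly S →ₗ[R] LocalFunctional δ := Submodule.mkQ _

variable {δ} in
lemma intx_eq_zero_iff {h : JetPoly S} : intx δ h = 0 ↔ ∃ r, totalDeriv δ r = h := by
  rw [intx, Submodule.mkQ_apply, Submodule.Quotient.mk_eq_zero]
  rfl

@[simp] lemma intx_totalDeriv (h : JetPoly S) : intx δ (totalDeriv δ h) = 0 :=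
  intx_eq_zero_iff.2 ⟨h, rfl⟩

variable {δ} in
lemma jetEuler_eq_zero_of_intx_eq_zero {h : JetPoly S} (hh : intx δ h = 0) : jetEuler δ h = 0 := by
  obtain ⟨r, rfl⟩ := intx_eq_zero_iff.1 hh
  exact jetEuler_totalDeriv δ r

lemma intx_mul_totalPow (k : ℕ) (a b : JetPoly S) :
    intx δ (a * totalPow δ k b) = intx δ (b * ((-1) ^ k * totalPow δ k a)) := by
  induction k generalizing a with
  | zero => simp [mul_comm]
  | succ k ih =>
    have by_parts : a * totalPow δ (k + 1) b =
        totalDeriv δ (a * totalPow δ k b) + (-totalDeriv δ a) * totalPow δ k b := by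
      rw [Derivation.leibniz, totalPow_succ, smul_eq_mul, smul_eq_mul]
      ring
    rw [by_parts, map_add, intx_totalDeriv, zero_add, ih, map_neg, totalPow_totalDeriv, pow_succ]
    congr 1
    ring

/-- The evolutionary derivation with characteristic `Q`: the derivative along the flow `u_t = Q`,
which commutes with `∂_x`. -/
def evo (Q : JetPoly S) : Derivation R (JetPoly S) (JetPoly S) :=
  jetDerivation δ fun k => totalPow δ k Q

@[simp] lemma evo_C (Q : JetPoly S) (f : S) : evo δ Q (C f) = Q * C (δ f) := jetDerivation_C ..
@[simp] lemma evo_X (Q : JetPoly S) (k : ℕ) : evo δ Q (X k) = totalPow δ (k + 1) Q :=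
  jetDerivation_X ..

/-- The formal adjoint of the Fréchet derivative `Q ↦ evo δ Q b`, applied to `a`. -/
def evoAdj (b a : JetPoly S) : JetPoly S :=
  ∑ k ∈ Finset.range (jetOrder b), (-1) ^ k * totalPow δ k (a * jetPartial δ k b)

lemma intx_mul_evo (a Q b : JetPoly S) :
    intx δ (a * evo δ Q b) = intx δ (Q * evoAdj δ b a) := by
  rw [evo, jetDerivation_eq_sum δ _ _ le_rfl, evoAdj, Finset.mul_sum, Finset.mul_sum, map_sum,
    map_sum]
  refine Finset.sum_congr rfl fun k _ => ?_
  rw [← intx_mul_totalPow, mul_comm (totalPow δ k Q), mul_assoc]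

lemma intx_evo (Q h : JetPoly S) : intx δ (evo δ Q h) = intx δ (Q * jetEuler δ h) := by
  simpa only [one_mul, evoAdj, jetEuler] using intx_mul_evo δ 1 Q h

lemma evo_totalDeriv (Q h : JetPoly S) : evo δ Q (totalDeriv δ h) = totalDeriv δ (evo δ Q h) := by
  have commute : ⁅evo δ Q, totalDeriv δ⁆ = 0 := by
    refine derivation_ext_of_C_X (fun f => ?_) fun k => ?_
    · simp only [Derivation.commutator_apply, totalDeriv_C, evo_C, Derivation.leibniz, evo_X,
        totalPow_succ, totalPow_zero, smul_eq_mul, Derivation.zero_apply]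
      ring
    · simp [Derivation.commutator_apply, totalPow_succ]
  simpa [Derivation.commutator_apply, sub_eq_zero] using DFunLike.congr_fun commute h

lemma evo_totalPow (Q h : JetPoly S) (k : ℕ) :
    evo δ Q (totalPow δ k h) = totalPow δ k (evo δ Q h) := by
  induction k with
  | zero => rfl
  | succ k ih => rw [totalPow_succ, totalPow_succ, evo_totalDeriv, ih]

variable {δ} in
lemma intx_evo_congr {h k : JetPoly S} (Q : JetPoly S) (hk : intx δ h = intx δ k) :
    intx δ (evo δ Q h) = intx δ (evo δ Q k) := by
  rw [← sub_eq_zero, ← map_sub] at hk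
  obtain ⟨r, hr⟩ := intx_eq_zero_iff.1 hk
  rw [← sub_eq_zero, ← map_sub, ← map_sub, ← hr, evo_totalDeriv, intx_totalDeriv]

lemma commutator_evo (P Q : JetPoly S) :
    ⁅evo δ P, evo δ Q⁆ = evo δ (evo δ P Q - evo δ Q P) := by
  refine derivation_ext_of_C_X (fun f => ?_) fun k => ?_
  · simp only [Derivation.commutator_apply, evo_C, Derivation.leibniz, smul_eq_mul]
    ring
  · simp only [Derivation.commutator_apply, evo_X, evo_totalPow, map_sub]

lemma secondVariation_comm (h P Q : JetPoly S) :
    intx δ (evo δ P (jetEuler δ h) * Q) = intx δ (evo δ Q (jetEuler δ h) * P) := by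
  have second_variation (P Q : JetPoly S) : intx δ (evo δ P (evo δ Q h)) =
      intx δ (evo δ P Q * jetEuler δ h) + intx δ (evo δ P (jetEuler δ h) * Q) := by
    rw [intx_evo_congr P (intx_evo δ Q h), Derivation.leibniz, smul_eq_mul, smul_eq_mul, map_add,
      add_comm, mul_comm (jetEuler δ h), mul_comm Q]
  have commutator := congrArg (intx δ) (DFunLike.congr_fun (commutator_evo δ P Q) h)
  rw [Derivation.commutator_apply, map_sub, second_variation, second_variation, intx_evo, sub_mul,
    map_sub, ← sub_eq_zero] at commutator
  rw [← sub_eq_zero, ← commutator]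
  abel

end Jets

/-! ## The grading -/

section Grading

variable {R S : Type*} [CommRing R] [CommRing S] [Algebra R S]

/-- Homogeneity of degree `d` for the grading in which `u^{(k)}` has degree `k`. -/
abbrev JetHomog (h : JetPoly S) (d : ℕ) : Prop :=
  IsWeightedHomogeneous (fun k : ℕ => k + 1) h d

lemma jetHomog_C (f : S) : JetHomog (C f) 0 := isWeightedHomogeneous_C _ f

lemma jetHomog_X (k : ℕ) : JetHomog (X k : JetPoly S) (k + 1) := isWeightedHomogeneous_X S _ k

namespace JetHomog

lemma of_eq {h : JetPoly S} {d e : ℕ} (hh : JetHomog h d) (hde : d = e) : JetHomog h e := hde ▸ hh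

lemma mul {a b : JetPoly S} {d e : ℕ} (ha : JetHomog a d) (hb : JetHomog b e) :
    JetHomog (a * b) (d + e) := IsWeightedHomogeneous.mul ha hb

lemma neg_one_pow_mul {h : JetPoly S} {d : ℕ} (hh : JetHomog h d) (k : ℕ) :
    JetHomog ((-1) ^ k * h) d := by
  obtain hk | hk := neg_one_pow_eq_or (JetPoly S) k
  · rwa [hk, one_mul]
  · rw [hk, neg_one_mul]
    exact IsWeightedHomogeneous.neg hh

lemma pderiv_eq_zero {h : JetPoly S} {d k : ℕ} (hh : JetHomog h d) (hk : d < k + 1) :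
    pderiv k h = 0 := by
  ext1 m
  rw [coeff_pderiv, coeff_zero]
  refine mul_eq_zero_of_left (hh.coeff_eq_zero _ fun hm => ?_) _
  simp only [map_add, Finsupp.weight_single, one_smul] at hm
  omega

variable {δ : Derivation R S S}

lemma jetPartial {h : JetPoly S} {d : ℕ} (hh : JetHomog h d) (k : ℕ) :
    jetPartial δ k h = 0 ∨ ∃ e, e + k = d ∧ JetHomog (jetPartial δ k h) e := by
  obtain _ | k := k
  · refine Or.inr ⟨d, rfl, fun m hm => hh fun hm0 => hm ?_⟩
    rw [jetPartial_zero, coeff_coeffDerivation, hm0, map_zero]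
  · obtain hk | hk := lt_or_ge d (k + 1)
    · exact Or.inl (hh.pderiv_eq_zero hk)
    · obtain ⟨e, rfl⟩ := Nat.exists_eq_add_of_le' hk
      exact Or.inr ⟨e, rfl, IsWeightedHomogeneous.pderiv hh rfl⟩

lemma mul_jetPartial {a h : JetPoly S} {d e k : ℕ} (ha : JetHomog a (e + k))
    (hh : JetHomog h d) : JetHomog (a * FormalVar.jetPartial δ k h) (e + d) := by
  obtain h0 | ⟨d', rfl, h'⟩ := hh.jetPartial (δ := δ) k
  · rw [h0, mul_zero]
    exact isWeightedHomogeneous_zero _ _ _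
  · exact (ha.mul h').of_eq (by omega)

lemma totalDeriv {h : JetPoly S} {d : ℕ} (hh : JetHomog h d) :
    JetHomog (totalDeriv δ h) (d + 1) := by
  rw [FormalVar.totalDeriv, jetDerivation_eq_sum δ _ _ le_rfl, add_comm d]
  exact IsWeightedHomogeneous.sum _ _ _ fun k _ =>
    mul_jetPartial ((jetHomog_X k).of_eq (add_comm k 1)) hh

lemma totalPow {h : JetPoly S} {d : ℕ} (hh : JetHomog h d) (k : ℕ) :
    JetHomog (totalPow δ k h) (d + k) := by
  induction k with
  | zero => exact hh
  | succ k ih => rw [totalPow_succ]; exact ih.totalDeriv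

lemma evo {Q h : JetPoly S} {d e : ℕ} (hQ : JetHomog Q e) (hh : JetHomog h d) :
    JetHomog (evo δ Q h) (e + d) := by
  rw [FormalVar.evo, jetDerivation_eq_sum δ _ _ le_rfl]
  exact IsWeightedHomogeneous.sum _ _ _ fun k _ => (hQ.totalPow k).mul_jetPartial hh

lemma evoAdj {a b : JetPoly S} {d e : ℕ} (ha : JetHomog a d) (hb : JetHomog b e) :
    JetHomog (evoAdj δ b a) (d + e) := by
  refine IsWeightedHomogeneous.sum _ _ _ fun k _ => neg_one_pow_mul ?_ k
  obtain h0 | ⟨e', rfl, h'⟩ := hb.jetPartial (δ := δ) k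
  · rw [h0, mul_zero, map_zero]
    exact isWeightedHomogeneous_zero _ _ _
  · rw [← add_assoc]
    exact (ha.mul h').totalPow k

end JetHomog

end Grading

/-! ## Differential operators and the Jacobi identity -/

section Operators

variable {R S : Type*} [CommRing R] [CommRing S] [Algebra R S] (δ : Derivation R S S)

/-- The differential operator `∑_{s < N} a_s ∂_x^s`. -/
def diffOp (a : ℕ → JetPoly S) (N : ℕ) : JetPoly S →ₗ[R] JetPoly S :=
  ∑ s ∈ Finset.range N, (LinearMap.mulLeft R (a s)).comp (totalPow δ s)

lemma diffOp_apply (a : ℕ → JetPoly S) (N : ℕ) (h : JetPoly S) :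
    diffOp δ a N h = ∑ s ∈ Finset.range N, a s * totalPow δ s h := by
  simp [diffOp]

/-- The formal adjoint `∑_{s < N} (-∂_x)^s a_s` of `diffOp δ a N`. -/
def diffOpAdj (a : ℕ → JetPoly S) (N : ℕ) (h : JetPoly S) : JetPoly S :=
  ∑ s ∈ Finset.range N, (-1) ^ s * totalPow δ s (h * a s)

lemma intx_mul_diffOp (a : ℕ → JetPoly S) (N : ℕ) (f g : JetPoly S) :
    intx δ (f * diffOp δ a N g) = intx δ (g * diffOpAdj δ a N f) := by
  rw [diffOp_apply, diffOpAdj, Finset.mul_sum, Finset.mul_sum, map_sum, map_sum]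
  refine Finset.sum_congr rfl fun s _ => ?_
  rw [← intx_mul_totalPow, mul_assoc]

/-- The derivative of the operator `diffOp δ a N` along the flow `u_t = Q`. -/
def evoOp (Q : JetPoly S) (a : ℕ → JetPoly S) (N : ℕ) : JetPoly S →ₗ[R] JetPoly S :=
  diffOp δ (fun s => evo δ Q (a s)) N

lemma evo_diffOp (Q : JetPoly S) (a : ℕ → JetPoly S) (N : ℕ) (h : JetPoly S) :
    evo δ Q (diffOp δ a N h) = evoOp δ Q a N h + diffOp δ a N (evo δ Q h) := by
  rw [diffOp_apply, diffOp_apply, evoOp, diffOp_apply, map_sum, ← Finset.sum_add_distrib]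
  refine Finset.sum_congr rfl fun s _ => ?_
  rw [Derivation.leibniz, evo_totalPow, smul_eq_mul, smul_eq_mul]
  ring

/-- Homogeneity of degree `n` of the operator `diffOp δ a N`, where `∂_x` has degree `1`. -/
def OpHomog (a : ℕ → JetPoly S) (N n : ℕ) : Prop :=
  ∀ s < N, ∃ e, e + s = n ∧ JetHomog (a s) e

variable {δ}

lemma OpHomog.diffOp {a : ℕ → JetPoly S} {N n d : ℕ} (ha : OpHomog a N n) {h : JetPoly S}
    (hh : JetHomog h d) : JetHomog (diffOp δ a N h) (n + d) := by
  rw [diffOp_apply]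
  refine IsWeightedHomogeneous.sum _ _ _ fun s hs => ?_
  obtain ⟨e, rfl, he⟩ := ha s (Finset.mem_range.1 hs)
  exact (he.mul (hh.totalPow s)).of_eq (by omega)

lemma OpHomog.diffOpAdj {a : ℕ → JetPoly S} {N n d : ℕ} (ha : OpHomog a N n) {h : JetPoly S}
    (hh : JetHomog h d) : JetHomog (diffOpAdj δ a N h) (n + d) := by
  refine IsWeightedHomogeneous.sum _ _ _ fun s hs => JetHomog.neg_one_pow_mul ?_ s
  obtain ⟨e, rfl, he⟩ := ha s (Finset.mem_range.1 hs)
  exact ((hh.mul he).totalPow s).of_eq (by omega)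

lemma OpHomog.evo {a : ℕ → JetPoly S} {N n e : ℕ} (ha : OpHomog a N n) {Q : JetPoly S}
    (hQ : JetHomog Q e) : OpHomog (fun s => evo δ Q (a s)) N (e + n) := by
  intro s hs
  obtain ⟨d, rfl, hd⟩ := ha s hs
  exact ⟨e + d, by omega, hQ.evo hd⟩

variable (δ) in
/-- Skew-symmetry of an operator for the pairing `∫ f g dx`. -/
def IsSkewOp (P : JetPoly S →ₗ[R] JetPoly S) : Prop :=
  ∀ f g, intx δ (f * P g + g * P f) = 0

lemma IsSkewOp.intx_mul {P : JetPoly S →ₗ[R] JetPoly S} (hP : IsSkewOp δ P) (f g : JetPoly S) :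
    intx δ (f * P g) = -intx δ (g * P f) := by
  rw [eq_neg_iff_add_eq_zero, ← map_add, hP]

/-- The sum of `φ` over the cyclic permutations of its arguments. -/
def cyclicSum {α V : Type*} [Add V] (φ : α → α → α → V) (a b c : α) : V :=
  φ a b c + φ b c a + φ c a b

lemma cyclicSum_rotate {α V : Type*} [AddCommMonoid V] (φ : α → α → α → V) (a b c : α) :
    cyclicSum φ b c a = cyclicSum φ a b c := by
  simp only [cyclicSum]
  abel

variable (δ) in
/-- The trilinear form `∫ f (D_{Q h} P) g dx` with `P = diffOp δ a N`, where `D_{Q h}` is the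
derivative along the flow `u_t = Q h`. -/
def tripleForm (a : ℕ → JetPoly S) (N : ℕ) (Q : JetPoly S →ₗ[R] JetPoly S)
    (f g h : JetPoly S) : LocalFunctional δ :=
  intx δ (f * evoOp δ (Q h) a N g)

variable (δ) in
/-- The iterated bracket `{{F, G}_P, H}_Q`. -/
def doubleBracket (P Q : JetPoly S →ₗ[R] JetPoly S) (F G H : JetPoly S) : LocalFunctional δ :=
  intx δ (jetEuler δ (jetEuler δ F * P (jetEuler δ G)) * Q (jetEuler δ H))

lemma doubleBracket_eq {a : ℕ → JetPoly S} {N : ℕ} (hP : IsSkewOp δ (diffOp δ a N))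
    (Q : JetPoly S →ₗ[R] JetPoly S) (F G H : JetPoly S) :
    doubleBracket δ (diffOp δ a N) Q F G H =
      intx δ (evo δ (Q (jetEuler δ H)) (jetEuler δ F) * diffOp δ a N (jetEuler δ G))
      - intx δ (evo δ (Q (jetEuler δ H)) (jetEuler δ G) * diffOp δ a N (jetEuler δ F))
      + tripleForm δ a N Q (jetEuler δ F) (jetEuler δ G) (jetEuler δ H) := by
  rw [doubleBracket, mul_comm, ← intx_evo, Derivation.leibniz, evo_diffOp, smul_eq_mul, smul_eq_mul,
    mul_add, map_add, map_add, hP.intx_mul (jetEuler δ F), tripleForm, mul_comm (diffOp δ a N _)]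
  abel

/-- Integrating by parts removes all derivatives from the first argument of the cyclic sum. -/
lemma exists_cyclicSum_tripleForm_eq {a b : ℕ → JetPoly S} {N M n m d e : ℕ}
    (ha : OpHomog a N n) (hb : OpHomog b M m) {g h : JetPoly S} (hg : JetHomog g d)
    (hh : JetHomog h e) :
    ∃ W, JetHomog W (n + m + d + e) ∧
      ∀ f, cyclicSum (tripleForm δ a N (diffOp δ b M)) f g h = intx δ (f * W) := by
  set V := ∑ s ∈ Finset.range N, evoAdj δ (a s) (g * totalPow δ s h) with hV
  have hV_homog : JetHomog V (d + e + n) := by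
    refine IsWeightedHomogeneous.sum _ _ _ fun s hs => ?_
    obtain ⟨k, rfl, hk⟩ := ha s (Finset.mem_range.1 hs)
    exact ((hg.mul (hh.totalPow s)).evoAdj hk).of_eq (by omega)
  have intx_V (f : JetPoly S) :
      tripleForm δ a N (diffOp δ b M) g h f = intx δ (f * diffOpAdj δ b M V) := by
    rw [← intx_mul_diffOp, tripleForm, mul_comm V, hV, Finset.mul_sum, map_sum, evoOp,
      diffOp_apply, Finset.mul_sum, map_sum]
    refine Finset.sum_congr rfl fun s _ => ?_
    rw [← intx_mul_evo]
    congr 1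
    ring
  refine ⟨evoOp δ (diffOp δ b M h) a N g + diffOpAdj δ b M V
    + diffOpAdj δ (fun s => evo δ (diffOp δ b M g) (a s)) N h, ?_, fun f => ?_⟩
  · refine .add (.add ?_ ?_) ?_
    · exact ((ha.evo (hb.diffOp hh)).diffOp hg).of_eq (by omega)
    · exact (hb.diffOpAdj hV_homog).of_eq (by omega)
    · exact ((ha.evo (hb.diffOp hg)).diffOpAdj hh).of_eq (by omega)
  · rw [cyclicSum, intx_V, mul_add, mul_add, map_add, map_add,
      ← intx_mul_diffOp δ (fun s => evo δ (diffOp δ b M g) (a s))]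
    rfl

end Operators

/-! ## Functions of `u` as test functions -/

section TestFunctions

variable {R S K X₀ : Type*} [CommRing R] [CommRing S] [Algebra R S] [CommRing K]
  {δ : Derivation R S S}

/-- A realization of a differential algebra by `K`-valued functions on a set `X₀`, with a
coordinate function centred at each point. -/
structure Realization (δ : Derivation R S S) (K X₀ : Type*) [CommRing K] where
  /-- The value of a function at a point. -/
  ev : X₀ → S →+* K
  ext : ∀ f g, (∀ x, ev x f = ev x g) → f = g
  /-- The coordinate centred at a point. -/
  coord : X₀ → S
  ev_coord : ∀ x, ev x (coord x) = 0
  deriv_coord : ∀ x, δ (coord x) = 1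

/-- Only the term of lowest order in `u - a` of a derivative of `(u - a) ^ (k + j) * b` matters
near `u = a`. -/
lemma exists_totalPow_pow_mul_eq {v : S} (hv : δ v = 1) (k j : ℕ) (b : JetPoly S) :
    ∃ r : JetPoly S, ∃ d : ℕ, d ≠ 0 ∧ totalPow δ k (C v ^ (k + j) * b) =
      C v ^ (j + 1) * r + (d : JetPoly S) * (C v ^ j * X 0 ^ k * b) := by
  have totalDeriv_v : totalDeriv δ (C v : JetPoly S) = X 0 := by
    rw [totalDeriv_C, hv, C_1, mul_one]
  induction k generalizing j with
  | zero => exact ⟨0, 1, one_ne_zero, by simp⟩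
  | succ k ih =>
    obtain ⟨r, d, hd, h⟩ := ih (j + 1)
    refine ⟨((j + 2 : ℕ) : JetPoly S) * X 0 * r + C v * totalDeriv δ r
      + (d : JetPoly S) * totalDeriv δ (X 0 ^ k * b), d * (j + 1),
      mul_ne_zero hd (by omega), ?_⟩
    rw [totalPow_succ, show k + 1 + j = k + (j + 1) by omega, h, mul_assoc (C v ^ (j + 1)),
      mul_left_comm (d : JetPoly S), map_add, Derivation.leibniz, Derivation.leibniz,
      Derivation.leibniz_pow, Derivation.leibniz_pow, Derivation.leibniz, Derivation.map_natCast,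
      totalDeriv_v]
    simp only [smul_eq_mul, nsmul_eq_mul, Nat.add_sub_cancel, mul_zero, add_zero]
    push_cast
    ring

lemma jetEuler_C_mul (f : S) (W : JetPoly S) {N : ℕ} (hN : jetOrder W ≤ N) :
    jetEuler δ (C f * W) = C (δ f) * W
      + ∑ k ∈ Finset.range N, (-1) ^ k * totalPow δ k (C f * jetPartial δ k W) := by
  have order_le : jetOrder (C f * W) ≤ N := by
    classical
    exact le_trans (Nat.succ_le_succ (Finset.sup_mono ((vars_mul _ _).trans (by simp)))) hN
  have order_ne : jetOrder W ≠ 0 := by simp [jetOrder]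
  obtain ⟨N, rfl⟩ := Nat.exists_eq_succ_of_ne_zero (by omega : N ≠ 0)
  rw [jetEuler_eq_sum _ _ order_le, Finset.sum_range_succ', Finset.sum_range_succ']
  simp only [jetPartial_succ_apply, jetPartial_zero, pow_zero, one_mul, totalPow_zero,
    Derivation.leibniz, coeffDerivation_C, pderiv_C, smul_eq_mul, mul_zero, add_zero]
  ring

lemma mkDerivation_weight_X {σ A : Type*} [CommRing A] {w : σ → ℕ} {p : MvPolynomial σ A} {n : ℕ}
    (hp : IsWeightedHomogeneous w p n) :
    mkDerivation A (fun i => (w i : MvPolynomial σ A) * X i) p = (n : MvPolynomial σ A) * p := by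
  conv_lhs => rw [p.as_sum]
  conv_rhs => rw [p.as_sum]
  rw [map_sum, Finset.mul_sum]
  refine Finset.sum_congr rfl fun m hm => ?_
  rw [mem_support_iff] at hm
  rw [mkDerivation_eq_sum _ _ (vars_monomial hm).subset, ← hp hm, Finsupp.weight_apply,
    Finsupp.sum, Nat.cast_sum, Finset.sum_mul]
  refine Finset.sum_congr rfl fun i _ => ?_
  rw [mul_assoc, X_mul_pderiv_monomial, smul_eq_mul, nsmul_eq_mul]
  push_cast
  ring

namespace Realization

variable (ρ : Realization δ K X₀)
include ρ

lemma map_ext {p q : JetPoly S} (h : ∀ x, map (ρ.ev x) p = map (ρ.ev x) q) : p = q := by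
  ext1 m
  refine ρ.ext _ _ fun x => ?_
  simpa only [coeff_map] using congrArg (coeff m) (h x)

lemma map_ev_totalPow_of_lt (x : X₀) {k m : ℕ} (hk : k < m) (b : JetPoly S) :
    map (ρ.ev x) (totalPow δ k (C (ρ.coord x ^ m) * b)) = 0 := by
  obtain ⟨j, rfl⟩ := Nat.exists_eq_add_of_lt hk
  obtain ⟨r, d, -, h⟩ := exists_totalPow_pow_mul_eq (ρ.deriv_coord x) k (j + 1) b
  rw [C_pow, add_assoc, h]
  simp [ρ.ev_coord]

lemma exists_map_ev_totalPow_self (x : X₀) (k : ℕ) (b : JetPoly S) :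
    ∃ d : ℕ, d ≠ 0 ∧ map (ρ.ev x) (totalPow δ k (C (ρ.coord x ^ k) * b)) =
      (d : JetPoly K) * X 0 ^ k * map (ρ.ev x) b := by
  obtain ⟨r, d, hd, h⟩ := exists_totalPow_pow_mul_eq (ρ.deriv_coord x) k 0 b
  refine ⟨d, hd, ?_⟩
  rw [add_zero] at h
  rw [C_pow, h]
  simp [ρ.ev_coord, mul_assoc]

lemma eq_X_zero_mul_pderiv {W : JetPoly S} (h : ∀ f, jetEuler δ (C f * W) = 0)
    (hW : ∀ m, 2 ≤ m → jetPartial δ m W = 0) : W = X 0 * pderiv 0 W := by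
  refine ρ.map_ext fun x => ?_
  have euler := jetEuler_C_mul (δ := δ) (ρ.coord x) W (le_max_left _ 2)
  rw [h, ρ.deriv_coord, C_1, one_mul,
    ← Finset.sum_subset (Finset.range_mono (le_max_right _ 2)) fun k _ hk => by
      rw [hW k (by simpa [Nat.succ_le_iff] using hk), mul_zero, map_zero, mul_zero]] at euler
  have euler_x := congrArg (map (ρ.ev x)) euler
  simp only [map_zero, Finset.sum_range_succ, Finset.range_one, Finset.sum_singleton, pow_zero,
    totalPow_zero, one_mul, pow_one, jetPartial_succ_apply, totalPow_succ, Derivation.leibniz,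
    smul_eq_mul, totalDeriv_C, ρ.deriv_coord, C_1, mul_one, neg_mul, neg_add_rev, map_add, map_mul,
    map_C, ρ.ev_coord, zero_mul, map_neg, map_X, neg_zero, add_zero, zero_add] at euler_x ⊢
  linear_combination -euler_x

variable [IsDomain K] [CharZero K]

lemma eq_zero_of_map_ev_totalPow_eq_zero {k : ℕ} {b : JetPoly S}
    (h : ∀ x, map (ρ.ev x) (totalPow δ k (C (ρ.coord x ^ k) * b)) = 0) : b = 0 := by
  refine ρ.map_ext fun x => ?_
  obtain ⟨d, hd, hb⟩ := ρ.exists_map_ev_totalPow_self x k b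
  rw [h x, eq_comm] at hb
  simpa [hd] using hb

lemma diffOp_coeff_eq_zero {c : ℕ → JetPoly S} {N : ℕ} (h : ∀ f, diffOp δ c N (C f) = 0) :
    ∀ s < N, c s = 0 := by
  induction N with
  | zero => simp
  | succ N ih =>
    have leading_eq_zero : c N = 0 := by
      refine ρ.map_ext fun x => ?_
      have ev_h := congrArg (map (ρ.ev x)) (h (ρ.coord x ^ N))
      have lower_eq_zero (s : ℕ) (hs : s ∈ Finset.range N) :
          map (ρ.ev x) (c s * totalPow δ s (C (ρ.coord x ^ N))) = 0 := by
        have := ρ.map_ev_totalPow_of_lt x (Finset.mem_range.1 hs) 1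
        rw [mul_one] at this
        rw [map_mul, this, mul_zero]
      obtain ⟨d, hd, ev_pow⟩ := ρ.exists_map_ev_totalPow_self x N 1
      rw [mul_one] at ev_pow
      rw [diffOp_apply, map_sum, map_zero, Finset.sum_range_succ, Finset.sum_eq_zero lower_eq_zero,
        zero_add, map_mul, ev_pow, map_one, mul_one] at ev_h
      simpa [hd] using ev_h
    intro s hs
    obtain hs | rfl := Nat.lt_succ_iff_lt_or_eq.1 hs
    · refine ih (fun f => ?_) s hs
      simpa [diffOp_apply, Finset.sum_range_succ, leading_eq_zero] using h f
    · exact leading_eq_zero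

lemma jetPartial_eq_zero {W : JetPoly S} (h : ∀ f, jetEuler δ (C f * W) = 0) {m : ℕ}
    (hm : 2 ≤ m) : jetPartial δ m W = 0 := by
  induction hj : jetOrder W - m using Nat.strong_induction_on generalizing m with
  | _ j ih =>
    obtain hmW | hmW := le_or_gt (jetOrder W) m
    · exact jetPartial_eq_zero_of_jetOrder_le hmW
    refine ρ.eq_zero_of_map_ev_totalPow_eq_zero (k := m) fun x => ?_
    have euler := congrArg (map (ρ.ev x)) (h (ρ.coord x ^ m))
    have ev_deriv : ρ.ev x (δ (ρ.coord x ^ m)) = 0 := by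
      simp [Derivation.leibniz_pow, ρ.deriv_coord, ρ.ev_coord, show m - 1 ≠ 0 by omega]
    rw [jetEuler_C_mul _ _ le_rfl, map_zero, map_add, map_mul, map_C, ev_deriv, C_0, zero_mul,
      zero_add, map_sum, Finset.sum_eq_single_of_mem m (Finset.mem_range.2 hmW) fun k _ hk => ?_]
      at euler
    · simpa using euler
    · obtain hk | hk := lt_or_gt_of_ne hk
      · rw [map_mul, ρ.map_ev_totalPow_of_lt x hk, mul_zero]
      · rw [ih _ (by omega) (by omega) rfl, mul_zero, map_zero, mul_zero, map_zero]

lemma eq_zero_of_intx_C_mul {W : JetPoly S} {n : ℕ} (hn : 2 ≤ n) (hW : JetHomog W n)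
    (h : ∀ f, intx δ (C f * W) = 0) : W = 0 := by
  classical
  have euler (f : S) := jetEuler_eq_zero_of_intx_eq_zero (h f)
  have high (m : ℕ) (hm : 2 ≤ m) : jetPartial δ m W = 0 := ρ.jetPartial_eq_zero euler hm
  have degree_mul : (n : JetPoly S) * W = W := by
    rw [← mkDerivation_weight_X hW, mkDerivation_eq_sum _ _ (Finset.subset_insert 0 _),
      Finset.sum_eq_single_of_mem 0 (Finset.mem_insert_self 0 _) fun k _ hk => ?_]
    · simpa using (ρ.eq_X_zero_mul_pderiv euler high).symm
    · rw [← jetPartial_succ_apply δ, high _ (by omega), mul_zero]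
  refine ρ.map_ext fun x => ?_
  have degree_sub_one_mul : ((n - 1 : ℕ) : JetPoly K) * map (ρ.ev x) W = 0 := by
    have := congrArg (map (ρ.ev x)) degree_mul
    rw [map_mul, map_natCast] at this
    rw [Nat.cast_sub (by omega)]
    linear_combination this
  rw [map_zero]
  exact (mul_eq_zero.1 degree_sub_one_mul).resolve_left (Nat.cast_ne_zero.2 (by omega))

end Realization

end TestFunctions

/-! ## Sums over antidiagonals -/

section Antidiagonals

variable {V : Type*} [AddCommMonoid V]

lemma sum_antidiagonal_triple_rotate (n : ℕ) (φ : ℕ → ℕ → ℕ → V) :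
    ∑ a ∈ antidiagonal n, ∑ b ∈ antidiagonal a.2, φ a.1 b.1 b.2 =
      ∑ a ∈ antidiagonal n, ∑ b ∈ antidiagonal a.2, φ b.2 a.1 b.1 := by
  rw [Finset.sum_sigma', Finset.sum_sigma']
  refine Finset.sum_nbij' (fun x => ⟨(x.2.1, x.2.2 + x.1.1), (x.2.2, x.1.1)⟩)
    (fun x => ⟨(x.2.2, x.1.1 + x.2.1), (x.1.1, x.2.1)⟩) ?_ ?_ ?_ ?_ ?_ <;>
  rintro ⟨⟨a, b⟩, ⟨c, d⟩⟩ h <;>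
  simp only [Finset.mem_sigma, mem_antidiagonal, and_true] at h ⊢
  · omega
  · omega
  · obtain ⟨-, rfl⟩ := h; rfl
  · obtain ⟨-, rfl⟩ := h; rfl

lemma sum_antidiagonal_triple_swap (n : ℕ) (φ : ℕ → ℕ → ℕ → V) :
    ∑ a ∈ antidiagonal n, ∑ b ∈ antidiagonal a.2, φ a.1 b.1 b.2 =
      ∑ a ∈ antidiagonal n, ∑ b ∈ antidiagonal a.2, φ b.2 b.1 a.1 :=
  (Finset.sum_congr rfl fun a _ =>
    (Finset.Nat.sum_antidiagonal_swap (f := fun b => φ a.1 b.1 b.2)).symm).trans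
    (sum_antidiagonal_triple_rotate n fun i j k => φ i k j)

lemma sum_antidiagonal_quintuple (n : ℕ) (φ : ℕ → ℕ → ℕ → ℕ → ℕ → V) :
    ∑ a ∈ antidiagonal n, ∑ b ∈ antidiagonal a.2,
      ∑ a' ∈ antidiagonal a.1, ∑ b' ∈ antidiagonal a'.2, φ a'.1 b'.1 b'.2 b.1 b.2 =
    ∑ t ∈ antidiagonal n, ∑ s ∈ antidiagonal t.2,
      ∑ r ∈ antidiagonal s.2, ∑ k ∈ antidiagonal t.1, φ s.1 k.1 r.1 k.2 r.2 := by
  simp only [Finset.sum_sigma']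
  refine Finset.sum_nbij'
    (fun x => ⟨(x.2.2.2.1 + x.2.1.1, x.2.2.1.1 + (x.2.2.2.2 + x.2.1.2)),
      ⟨(x.2.2.1.1, x.2.2.2.2 + x.2.1.2), ⟨(x.2.2.2.2, x.2.1.2), (x.2.2.2.1, x.2.1.1)⟩⟩⟩)
    (fun x => ⟨(x.2.1.1 + (x.2.2.2.1 + x.2.2.1.1), x.2.2.2.2 + x.2.2.1.2),
      ⟨(x.2.2.2.2, x.2.2.1.2), ⟨(x.2.1.1, x.2.2.2.1 + x.2.2.1.1), (x.2.2.2.1, x.2.2.1.1)⟩⟩⟩)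
    ?_ ?_ ?_ ?_ ?_ <;>
  rintro ⟨⟨a, b⟩, ⟨⟨c, d⟩, ⟨⟨e, f⟩, ⟨g, h⟩⟩⟩⟩ hx <;>
  simp only [Finset.mem_sigma, mem_antidiagonal, and_true] at hx ⊢
  · omega
  · omega
  · obtain ⟨-, rfl, rfl, rfl⟩ := hx; rfl
  · obtain ⟨-, rfl, rfl, rfl⟩ := hx; rfl

lemma sum_antidiagonal_triple_eq_single (n : ℕ) (φ : ℕ → ℕ → ℕ → V)
    (h : ∀ i k j, k < n → φ i k j = 0) :
    ∑ a ∈ antidiagonal n, ∑ b ∈ antidiagonal a.2, φ a.1 b.1 b.2 = φ 0 n 0 := by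
  rw [Finset.sum_eq_single_of_mem (0, n) (by simp),
    Finset.sum_eq_single_of_mem (n, 0) (by simp)]
  · rintro ⟨k, j⟩ hb hne
    rw [mem_antidiagonal] at hb
    exact h _ _ _ (by grind)
  · rintro ⟨i, m⟩ ha hne
    refine Finset.sum_eq_zero fun b hb => h _ _ _ ?_
    rw [mem_antidiagonal] at ha hb
    grind

end Antidiagonals

/-! ## Brackets of local functionals -/

section Brackets

variable {R S : Type*} [CommRing R] [CommRing S] [Algebra R S]

lemma JetHomog.induction {p : JetPoly S → Prop} (add : ∀ a b, p a → p b → p (a + b))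
    (homog : ∀ d a, JetHomog a d → p a) (a : JetPoly S) : p a := by
  induction a using MvPolynomial.monomial_add_induction_on with
  | C a => exact homog 0 _ (jetHomog_C a)
  | monomial_add m b f _ _ hf =>
    exact add _ _ (homog _ _ (isWeightedHomogeneous_monomial _ m b rfl)) hf

/-- Homogeneity of degree `k + 1` of the terms of order `k` of a bracket. -/
def JetGraded (A : ℕ → ℕ → JetPoly S) : Prop := ∀ k, OpHomog (A k) (k + 2) (k + 1)

variable (δ : Derivation R S S)

/-- The operator `∑_s A_{k,s} ∂_x^s` given by the terms of order `k` of a bracket. -/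
abbrev bracketOp (A : ℕ → ℕ → JetPoly S) (k : ℕ) : JetPoly S →ₗ[R] JetPoly S :=
  diffOp δ (A k) (k + 2)

/-- The density of the bracket of two local functionals. -/
def jetBracket (A : ℕ → ℕ → JetPoly S) (F G : ℕ → JetPoly S) (n : ℕ) : JetPoly S :=
  ∑ a ∈ antidiagonal n, ∑ b ∈ antidiagonal a.2,
    jetEuler δ (F a.1) * bracketOp δ A b.1 (jetEuler δ (G b.2))

/-- A family of functionals `∫ (f + O(ε)) dx`, one for each function `f` of `u`, which commute
modulo `O(ε^N)`. -/
structure IsCommutingFamily (A : ℕ → ℕ → JetPoly S) (H : S → ℕ → JetPoly S) (N : ℕ) : Prop where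
  leading : ∀ f, H f 0 = C f
  commute : ∀ f g, ∀ n < N, intx δ (jetBracket δ A (H f) (H g) n) = 0

/-- The obstruction of order `N` to the Jacobi identity for functionals without `ε`. -/
def jacobiSum (A : ℕ → ℕ → JetPoly S) (N : ℕ) (F G H : JetPoly S) : LocalFunctional δ :=
  ∑ k ∈ antidiagonal N, cyclicSum (doubleBracket δ (bracketOp δ A k.1) (bracketOp δ A k.2)) F G H

/-- The trilinear form in the variational derivatives that represents `jacobiSum` when the bracket
is skew-symmetric. -/
def jacobiForm (A : ℕ → ℕ → JetPoly S) (N : ℕ) (f g h : JetPoly S) : LocalFunctional δ :=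
  ∑ k ∈ antidiagonal N, cyclicSum (tripleForm δ (A k.1) (k.1 + 2) (bracketOp δ A k.2)) f g h

variable {δ}

lemma jetBracket_add (A : ℕ → ℕ → JetPoly S) (F G : ℕ → JetPoly S) (n : ℕ) :
    jetBracket δ A F G n + jetBracket δ A G F n =
      ∑ a ∈ antidiagonal n, ∑ b ∈ antidiagonal a.2,
        (jetEuler δ (F a.1) * bracketOp δ A b.1 (jetEuler δ (G b.2)) +
          jetEuler δ (G b.2) * bracketOp δ A b.1 (jetEuler δ (F a.1))) := by
  simp only [Finset.sum_add_distrib]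
  rw [jetBracket, jetBracket, sum_antidiagonal_triple_swap n fun i k j =>
    jetEuler δ (G i) * bracketOp δ A k (jetEuler δ (F j))]

lemma intx_jetBracket_jetBracket (A : ℕ → ℕ → JetPoly S) (F G H : ℕ → JetPoly S) (n : ℕ) :
    intx δ (jetBracket δ A (jetBracket δ A F G) H n) =
      ∑ t ∈ antidiagonal n, ∑ s ∈ antidiagonal t.2, ∑ r ∈ antidiagonal s.2,
        ∑ k ∈ antidiagonal t.1,
          doubleBracket δ (bracketOp δ A k.1) (bracketOp δ A k.2) (F s.1) (G r.1) (H r.2) := by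
  rw [← sum_antidiagonal_quintuple n fun i k j l m =>
    doubleBracket δ (bracketOp δ A k) (bracketOp δ A l) (F i) (G j) (H m)]
  simp only [jetBracket, map_sum, jetEuler_sum, Finset.sum_mul, doubleBracket]

lemma intx_jacobi (A : ℕ → ℕ → JetPoly S) (F G H : ℕ → JetPoly S) (n : ℕ) :
    intx δ (jetBracket δ A (jetBracket δ A F G) H n + jetBracket δ A (jetBracket δ A G H) F n
      + jetBracket δ A (jetBracket δ A H F) G n) =
    ∑ t ∈ antidiagonal n, ∑ s ∈ antidiagonal t.2, ∑ r ∈ antidiagonal s.2,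
      jacobiSum δ A t.1 (F s.1) (G r.1) (H r.2) := by
  rw [map_add, map_add, intx_jetBracket_jetBracket, intx_jetBracket_jetBracket,
    intx_jetBracket_jetBracket, ← Finset.sum_add_distrib, ← Finset.sum_add_distrib]
  refine Finset.sum_congr rfl fun t _ => ?_
  set B := fun F G H : JetPoly S => ∑ k ∈ antidiagonal t.1,
    doubleBracket δ (bracketOp δ A k.1) (bracketOp δ A k.2) F G H
  have rotate_GHF := sum_antidiagonal_triple_rotate t.2 fun m i j => B (G i) (H j) (F m)
  have rotate_HFG := sum_antidiagonal_triple_rotate t.2 fun m i j => B (H m) (F i) (G j)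
  simp only [B] at rotate_GHF rotate_HFG
  rw [← rotate_GHF, rotate_HFG]
  simp only [jacobiSum, cyclicSum, Finset.sum_add_distrib]

/-- The terms with second variations cancel by symmetry of the second variation. -/
lemma jacobiSum_eq {A : ℕ → ℕ → JetPoly S} {N : ℕ} (hA : ∀ k ≤ N, IsSkewOp δ (bracketOp δ A k))
    (F G H : JetPoly S) :
    jacobiSum δ A N F G H =
      jacobiForm δ A N (jetEuler δ F) (jetEuler δ G) (jetEuler δ H) := by
  set V := fun F G H : JetPoly S => ∑ k ∈ antidiagonal N,
    intx δ (evo δ (bracketOp δ A k.2 (jetEuler δ H)) (jetEuler δ F) *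
      bracketOp δ A k.1 (jetEuler δ G)) with hV
  have V_symm (F G H : JetPoly S) : V F G H = V F H G := by
    simp only [hV]
    rw [← Finset.Nat.sum_antidiagonal_swap]
    exact Finset.sum_congr rfl fun k _ => secondVariation_comm δ F _ _
  have sum_doubleBracket (F G H : JetPoly S) : ∑ k ∈ antidiagonal N,
      doubleBracket δ (bracketOp δ A k.1) (bracketOp δ A k.2) F G H =
      V F G H - V G F H + ∑ k ∈ antidiagonal N, tripleForm δ (A k.1) (k.1 + 2)
        (bracketOp δ A k.2) (jetEuler δ F) (jetEuler δ G) (jetEuler δ H) := by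
    rw [← Finset.sum_sub_distrib, ← Finset.sum_add_distrib]
    refine Finset.sum_congr rfl fun k hk => doubleBracket_eq (hA k.1 ?_) _ F G H
    rw [mem_antidiagonal] at hk
    omega
  simp only [jacobiSum, jacobiForm, cyclicSum, Finset.sum_add_distrib, sum_doubleBracket]
  rw [V_symm F H G, V_symm G H F, V_symm H G F]
  abel

lemma evo_add (P Q h : JetPoly S) : evo δ (P + Q) h = evo δ P h + evo δ Q h := by
  simp only [evo, jetDerivation_eq_sum δ _ _ le_rfl, map_add, add_mul, Finset.sum_add_distrib]

lemma jacobiForm_rotate (A : ℕ → ℕ → JetPoly S) (N : ℕ) (f g h : JetPoly S) :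
    jacobiForm δ A N f g h = jacobiForm δ A N g h f :=
  Finset.sum_congr rfl fun _ _ => (cyclicSum_rotate ..).symm

lemma jacobiForm_add (A : ℕ → ℕ → JetPoly S) (N : ℕ) (f f' g h : JetPoly S) :
    jacobiForm δ A N (f + f') g h = jacobiForm δ A N f g h + jacobiForm δ A N f' g h := by
  rw [jacobiForm, jacobiForm, jacobiForm, ← Finset.sum_add_distrib]
  refine Finset.sum_congr rfl fun k _ => ?_
  simp only [cyclicSum, tripleForm, evoOp, diffOp_apply, map_add, evo_add, add_mul, mul_add,
    Finset.sum_add_distrib]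
  abel

lemma JetGraded.exists_jacobiForm_eq {A : ℕ → ℕ → JetPoly S} (hA : JetGraded A) (N : ℕ) {d e : ℕ}
    {g h : JetPoly S} (hg : JetHomog g d) (hh : JetHomog h e) :
    ∃ W, JetHomog W (N + 2 + d + e) ∧ ∀ f, jacobiForm δ A N f g h = intx δ (f * W) := by
  choose! W hW hf using fun k : ℕ × ℕ =>
    exists_cyclicSum_tripleForm_eq (δ := δ) (hA k.1) (hA k.2) hg hh
  refine ⟨∑ k ∈ antidiagonal N, W k, IsWeightedHomogeneous.sum _ _ _ fun k hk =>
    (hW k).of_eq ?_, fun f => ?_⟩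
  · rw [mem_antidiagonal] at hk
    omega
  · rw [Finset.mul_sum, map_sum]
    exact Finset.sum_congr rfl fun k _ => hf k f

end Brackets

section Determination

variable {R S K X₀ : Type*} [CommRing R] [CommRing S] [Algebra R S] [CommRing K] [IsDomain K]
  [CharZero K] {δ : Derivation R S S} (ρ : Realization δ K X₀)
include ρ

lemma Realization.opCoeff_eq_zero_of_intx_C {a : ℕ → JetPoly S} {N n : ℕ} (hn : 2 ≤ n)
    (ha : OpHomog a N n) (h : ∀ f g, intx δ (C f * diffOp δ a N (C g)) = 0) : ∀ s < N, a s = 0 :=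
  ρ.diffOp_coeff_eq_zero fun g =>
    ρ.eq_zero_of_intx_C_mul hn (ha.diffOp (jetHomog_C g)) fun f => h f g

lemma Realization.isSkewOp_of_C {a : ℕ → JetPoly S} {N n : ℕ} (hn : 2 ≤ n) (ha : OpHomog a N n)
    (h : ∀ f g, intx δ (C f * diffOp δ a N (C g) + C g * diffOp δ a N (C f)) = 0) :
    IsSkewOp δ (diffOp δ a N) := by
  have by_parts (f g : JetPoly S) : intx δ (f * diffOp δ a N g + g * diffOp δ a N f) =
      intx δ (f * (diffOp δ a N g + diffOpAdj δ a N g)) := by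
    rw [mul_add, map_add, map_add, intx_mul_diffOp δ _ _ g f]
  have eq_zero_of_homog {d : ℕ} {g : JetPoly S} (hg : JetHomog g d)
      (h0 : ∀ φ, intx δ (C φ * diffOp δ a N g + g * diffOp δ a N (C φ)) = 0) (f : JetPoly S) :
      intx δ (f * diffOp δ a N g + g * diffOp δ a N f) = 0 := by
    have hW : JetHomog (diffOp δ a N g + diffOpAdj δ a N g) (n + d) :=
      .add (ha.diffOp hg) (ha.diffOpAdj hg)
    rw [by_parts, ρ.eq_zero_of_intx_C_mul (by omega) hW fun φ => by rw [← by_parts, h0], mul_zero,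
      map_zero]
  intro f g
  induction g using JetHomog.induction with
  | add a b ha hb =>
    rw [map_add (diffOp δ _ N), mul_add, add_mul, add_add_add_comm, map_add, ha, hb, add_zero]
  | homog d g hg =>
    refine eq_zero_of_homog hg (fun φ => ?_) f
    rw [add_comm]
    exact eq_zero_of_homog (jetHomog_C φ) (fun ψ => h ψ φ) g

lemma JetGraded.jacobiForm_eq_zero {A : ℕ → ℕ → JetPoly S} (hA : JetGraded A) {N : ℕ}
    (hN : ∀ f g h : S, jacobiForm δ A N (C f) (C g) (C h) = 0) (f g h : JetPoly S) :
    jacobiForm δ A N f g h = 0 := by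
  have eq_zero_of_homog {d e : ℕ} {g h : JetPoly S} (hg : JetHomog g d) (hh : JetHomog h e)
      (h0 : ∀ φ, jacobiForm δ A N (C φ) g h = 0) (f : JetPoly S) : jacobiForm δ A N f g h = 0 := by
    obtain ⟨W, hW, hf⟩ := hA.exists_jacobiForm_eq (δ := δ) N hg hh
    rw [hf, ρ.eq_zero_of_intx_C_mul (by omega) hW fun φ => by rw [← hf, h0], mul_zero, map_zero]
  have add_middle {f a b h : JetPoly S} (ha : jacobiForm δ A N f a h = 0)
      (hb : jacobiForm δ A N f b h = 0) : jacobiForm δ A N f (a + b) h = 0 := by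
    rw [jacobiForm_rotate] at ha hb ⊢
    rw [jacobiForm_add, ha, hb, add_zero]
  have zero_of_C_C (f : JetPoly S) (g h : S) : jacobiForm δ A N f (C g) (C h) = 0 :=
    eq_zero_of_homog (jetHomog_C g) (jetHomog_C h) (fun φ => hN φ g h) f
  have zero_of_C (f g : JetPoly S) (h : S) : jacobiForm δ A N f g (C h) = 0 := by
    induction g using JetHomog.induction with
    | add a b ha hb => exact add_middle ha hb
    | homog d g hg =>
      refine eq_zero_of_homog hg (jetHomog_C h) (fun φ => ?_) f
      rw [jacobiForm_rotate, zero_of_C_C]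
  induction g using JetHomog.induction with
  | add a b ha hb => exact add_middle ha hb
  | homog d g hg =>
    rw [← jacobiForm_rotate]
    induction h using JetHomog.induction with
    | add a b ha hb => rw [jacobiForm_add, ha, hb, add_zero]
    | homog e h hh =>
      rw [jacobiForm_rotate]
      refine eq_zero_of_homog hg hh (fun φ => ?_) f
      rw [jacobiForm_rotate, zero_of_C]

namespace IsCommutingFamily

variable {A B : ℕ → ℕ → JetPoly S} {H : S → ℕ → JetPoly S} {N : ℕ}

lemma bracketOp_eq (hδ : Function.Surjective δ) (hAH : IsCommutingFamily δ A H N)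
    (hBH : IsCommutingFamily δ B H N) (hA : JetGraded A) (hB : JetGraded B) (h0 : A 0 = B 0) :
    ∀ k < N, ∀ s < k + 2, A k s = B k s := by
  intro k
  induction k using Nat.strong_induction_on with
  | _ k ih =>
  intro hk
  obtain rfl | hk0 := Nat.eq_zero_or_pos k
  · simp [h0]
  have homog_sub : OpHomog (fun s => A k s - B k s) (k + 2) (k + 1) := by
    intro s hs
    obtain ⟨e, he, h⟩ := hA k s hs
    obtain ⟨e', he', h'⟩ := hB k s hs
    obtain rfl : e = e' := by omega
    exact ⟨e, he, IsWeightedHomogeneous.sub h h'⟩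
  have diffOp_sub (g : JetPoly S) : diffOp δ (fun s => A k s - B k s) (k + 2) g =
      bracketOp δ A k g - bracketOp δ B k g := by
    simp only [diffOp_apply, sub_mul, Finset.sum_sub_distrib]
  refine fun s hs =>
    sub_eq_zero.1 (ρ.opCoeff_eq_zero_of_intx_C (by omega) homog_sub (fun f g => ?_) s hs)
  obtain ⟨f, rfl⟩ := hδ f
  obtain ⟨g, rfl⟩ := hδ g
  have op_eq (l : ℕ) (hl : l < k) (h : JetPoly S) : bracketOp δ A l h = bracketOp δ B l h := by
    simp only [diffOp_apply]
    exact Finset.sum_congr rfl fun s hs => by rw [ih l hl (by omega) s (Finset.mem_range.1 hs)]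
  have bracket_sub : jetBracket δ A (H f) (H g) k - jetBracket δ B (H f) (H g) k =
      jetEuler δ (H f 0) * bracketOp δ A k (jetEuler δ (H g 0)) -
      jetEuler δ (H f 0) * bracketOp δ B k (jetEuler δ (H g 0)) := by
    simp only [jetBracket, ← Finset.sum_sub_distrib]
    exact sum_antidiagonal_triple_eq_single k (fun i l j =>
      jetEuler δ (H f i) * bracketOp δ A l (jetEuler δ (H g j)) -
      jetEuler δ (H f i) * bracketOp δ B l (jetEuler δ (H g j)))
      fun i l j hl => by rw [op_eq l hl, sub_self]
  rw [hAH.leading, hAH.leading, jetEuler_C, jetEuler_C, ← mul_sub, ← diffOp_sub] at bracket_sub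
  rw [← bracket_sub, map_sub, hAH.commute f g k hk, hBH.commute f g k hk, sub_zero]

lemma isSkewOp (hδ : Function.Surjective δ) (hAH : IsCommutingFamily δ A H N) (hA : JetGraded A)
    (h0 : IsSkewOp δ (bracketOp δ A 0)) : ∀ k < N, IsSkewOp δ (bracketOp δ A k) := by
  intro k
  induction k using Nat.strong_induction_on with
  | _ k ih =>
  intro hk
  obtain rfl | hk0 := Nat.eq_zero_or_pos k
  · exact h0
  refine ρ.isSkewOp_of_C (by omega) (hA k) fun f g => ?_
  obtain ⟨f, rfl⟩ := hδ f
  obtain ⟨g, rfl⟩ := hδ g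
  have bracket_add := congrArg (intx δ) (jetBracket_add (δ := δ) A (H f) (H g) k)
  rw [map_add, hAH.commute f g k hk, hAH.commute g f k hk, add_zero] at bracket_add
  simp only [map_sum] at bracket_add
  rw [sum_antidiagonal_triple_eq_single k (fun i l j => intx δ
    (jetEuler δ (H f i) * bracketOp δ A l (jetEuler δ (H g j)) +
      jetEuler δ (H g j) * bracketOp δ A l (jetEuler δ (H f i))))
    fun i l j hl => ih l hl (by omega) _ _, hAH.leading, hAH.leading, jetEuler_C,
    jetEuler_C] at bracket_add
  exact bracket_add.symm

lemma jacobiSum_eq_zero (hδ : Function.Surjective δ) (hAH : IsCommutingFamily δ A H N)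
    (hA : JetGraded A) (hskew : ∀ k < N, IsSkewOp δ (bracketOp δ A k)) :
    ∀ k < N, ∀ F G K, jacobiSum δ A k F G K = 0 := by
  intro k
  induction k using Nat.strong_induction_on with
  | _ k ih =>
  intro hk F G K
  rw [jacobiSum_eq fun l hl => hskew l (by omega)]
  refine hA.jacobiForm_eq_zero ρ (fun f g h => ?_) _ _ _
  obtain ⟨f, rfl⟩ := hδ f
  obtain ⟨g, rfl⟩ := hδ g
  obtain ⟨h, rfl⟩ := hδ h
  have iterated_eq_zero (f g h : S) :
      jetBracket δ A (jetBracket δ A (H f) (H g)) (H h) k = 0 := by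
    refine Finset.sum_eq_zero fun a ha => Finset.sum_eq_zero fun b _ => ?_
    rw [mem_antidiagonal] at ha
    rw [jetEuler_eq_zero_of_intx_eq_zero (hAH.commute f g a.1 (by omega)), zero_mul]
  have jacobi := intx_jacobi (δ := δ) A (H f) (H g) (H h) k
  rw [iterated_eq_zero, iterated_eq_zero, iterated_eq_zero, add_zero, add_zero, map_zero,
    Finset.sum_eq_single_of_mem (k, 0) (by simp) fun t ht hne => ?_] at jacobi
  · simp only [Finset.Nat.antidiagonal_zero, Finset.sum_singleton, hAH.leading] at jacobi
    rw [jacobiSum_eq fun l hl => hskew l (by omega), jetEuler_C, jetEuler_C, jetEuler_C] at jacobi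
    exact jacobi.symm
  · rw [mem_antidiagonal] at ht
    have lower : t.1 < k := by
      contrapose! hne
      exact Prod.ext (by omega) (by simp only; omega)
    exact Finset.sum_eq_zero fun s _ => Finset.sum_eq_zero fun r _ =>
      ih t.1 lower (by omega) _ _ _

lemma intx_jetBracket_add_eq_zero (hδ : Function.Surjective δ) (hAH : IsCommutingFamily δ A H N)
    (hA : JetGraded A) (h0 : IsSkewOp δ (bracketOp δ A 0)) (F G : ℕ → JetPoly S) {n : ℕ}
    (hn : n < N) : intx δ (jetBracket δ A F G n + jetBracket δ A G F n) = 0 := by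
  simp only [jetBracket_add, map_sum]
  refine Finset.sum_eq_zero fun a ha => Finset.sum_eq_zero fun b hb => ?_
  rw [mem_antidiagonal] at ha hb
  exact hAH.isSkewOp ρ hδ hA h0 b.1 (by omega) _ _

lemma intx_jacobi_eq_zero (hδ : Function.Surjective δ) (hAH : IsCommutingFamily δ A H N)
    (hA : JetGraded A) (h0 : IsSkewOp δ (bracketOp δ A 0)) (F G K : ℕ → JetPoly S) {n : ℕ}
    (hn : n < N) :
    intx δ (jetBracket δ A (jetBracket δ A F G) K n + jetBracket δ A (jetBracket δ A G K) F n
      + jetBracket δ A (jetBracket δ A K F) G n) = 0 := by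
  rw [intx_jacobi]
  refine Finset.sum_eq_zero fun t ht => Finset.sum_eq_zero fun s _ => Finset.sum_eq_zero fun r _ =>
    hAH.jacobiSum_eq_zero ρ hδ hA (hAH.isSkewOp ρ hδ hA h0) t.1 ?_ _ _ _
  rw [mem_antidiagonal] at ht
  omega

end IsCommutingFamily

end Determination

/-! ## Smooth functions on an open set of the line -/

section SmoothFunctions

variable {I : TopologicalSpace.Opens ℝ}

@[ext] lemma smoothFun_ext {f g : SmoothFun I} (h : ∀ x, f.1 x = g.1 x) : f = g :=
  Subtype.ext (funext h)

lemma extend_apply_mem (f : I → ℝ) (x : I) : Function.extend Subtype.val f 0 (x : ℝ) = f x :=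
  Subtype.val_injective.extend_apply f 0 x

lemma hasDerivAt_extend (f : SmoothFun I) (x : I) :
    HasDerivAt (Function.extend Subtype.val f.1 0) ((D f).1 x) x :=
  (((f.2 : ContDiffOn ℝ ∞ _ _).differentiableOn (by simp)).differentiableAt
    (I.isOpen.mem_nhds x.2)).hasDerivAt

lemma D_apply_of_hasDerivAt {f : SmoothFun I} {F : ℝ → ℝ} {x : I} {a : ℝ}
    (hF : ∀ y : I, F y = f.1 y) (hd : HasDerivAt F a x) : (D f).1 x = a := by
  refine (hasDerivAt_extend f x).unique (hd.congr_of_eventuallyEq ?_)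
  filter_upwards [I.isOpen.mem_nhds x.2] with y hy
  lift y to I using hy
  rw [extend_apply_mem, hF]

lemma D_add (f g : SmoothFun I) : D (f + g) = D f + D g := by
  ext x
  exact D_apply_of_hasDerivAt (fun y => by simp)
    ((hasDerivAt_extend f x).add (hasDerivAt_extend g x))

lemma D_mul (f g : SmoothFun I) : D (f * g) = f * D g + g * D f := by
  ext x
  refine D_apply_of_hasDerivAt (fun y => by simp)
    (((hasDerivAt_extend f x).mul (hasDerivAt_extend g x)).congr_deriv ?_)
  simp only [Subtype.val_injective, Function.Injective.extend_apply, AddMemClass.coe_add,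
    MulMemClass.coe_mul, Pi.add_apply, Pi.mul_apply]
  ring

lemma D_smul (a : ℝ) (f : SmoothFun I) : D (a • f) = a • D f := by
  ext x
  exact D_apply_of_hasDerivAt (fun y => by simp) ((hasDerivAt_extend f x).const_mul a)

variable (I) in
/-- The derivative as a derivation of the algebra of smooth functions. -/
def derivD : Derivation ℝ (SmoothFun I) (SmoothFun I) :=
  Derivation.mk' { toFun := D, map_add' := D_add, map_smul' := D_smul }
    fun f g => D_mul f g

lemma derivD_apply (f : SmoothFun I) : derivD I f = D f := rfl

/-- The coordinate function `u ↦ u - a`. -/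
def coordSub (a : ℝ) : SmoothFun I :=
  ⟨fun x => x - a, by
    refine (contDiff_id.sub (contDiff_const (c := a))).contDiffOn.congr fun x hx => ?_
    lift x to I using hx
    rw [extend_apply_mem, id]⟩

lemma D_coordSub (a : ℝ) : D (coordSub a : SmoothFun I) = 1 := by
  ext x
  exact D_apply_of_hasDerivAt (fun y => rfl) ((hasDerivAt_id (x : ℝ)).sub_const a)

lemma exists_D_eq (hI : IsConnected (I : Set ℝ)) (f : SmoothFun I) : ∃ g, D g = f := by
  obtain ⟨a, ha⟩ := hI.nonempty
  have hord : (I : Set ℝ).OrdConnected := hI.isPreconnected.ordConnected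
  set F := Function.extend Subtype.val f.1 0 with hF
  have smooth_F : ContDiffOn ℝ ∞ F I := f.2
  have hasDerivAt_integral : ∀ x ∈ I, HasDerivAt (fun x => ∫ t in a..x, F t) (F x) x := by
    intro x hx
    refine intervalIntegral.integral_hasDerivAt_right
      (smooth_F.continuousOn.mono (hord.uIcc_subset ha hx)).intervalIntegrable ?_
      (smooth_F.continuousOn.continuousAt (I.isOpen.mem_nhds hx))
    exact smooth_F.continuousOn.stronglyMeasurableAtFilter I.isOpen x hx
  have smooth_integral : ContDiffOn ℝ ∞ (fun x => ∫ t in a..x, F t) I := by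
    rw [contDiffOn_infty_iff_deriv_of_isOpen I.isOpen]
    exact ⟨fun x hx => (hasDerivAt_integral x hx).differentiableAt.differentiableWithinAt,
      smooth_F.congr fun x hx => (hasDerivAt_integral x hx).deriv⟩
  refine ⟨⟨fun x => ∫ t in a..(x : ℝ), F t, smooth_integral.congr fun x hx => ?_⟩, ?_⟩
  · lift x to I using hx
    rw [extend_apply_mem]
  · ext x
    rw [D_apply_of_hasDerivAt (fun y => rfl) (hasDerivAt_integral x x.2), hF, extend_apply_mem]

/-- The value of a smooth function at a point, as a ring homomorphism. -/
def evalFun (x : I) : SmoothFun I →+* ℝ :=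
  (Pi.evalRingHom (fun _ : I => ℝ) x).comp (SmoothFun I).val.toRingHom

/-- Smooth functions on an open set of the line, realized by their values. -/
def smoothRealization : Realization (derivD I) ℝ I where
  ev := evalFun
  ext _ _ h := smoothFun_ext h
  coord x := coordSub x
  ev_coord x := sub_self (x : ℝ)
  deriv_coord x := D_coordSub (x : ℝ)

lemma partialU_eq (h : DiffPoly I) : partialU h = coeffDerivation (derivD I) h := rfl

lemma dx_eq (h : DiffPoly I) : dx h = totalDeriv (derivD I) h := by
  rw [dx, totalDeriv_apply, partialU_eq]

lemma dx_iterate_eq (k : ℕ) (h : DiffPoly I) : dx^[k] h = totalPow (derivD I) k h := by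
  rw [totalPow_apply, ← funext dx_eq]

lemma euler_eq (h : DiffPoly I) : euler h = jetEuler (derivD I) h := by
  simp only [euler, jetEuler_eq_sum_vars, dx_iterate_eq, partialU_eq]

lemma applyOp_eq (A : BracketCoeffs I) (k : ℕ) (h : DiffPoly I) :
    applyOp A k h = bracketOp (derivD I) A k h := by
  rw [diffOp_apply]
  simp only [applyOp, dx_iterate_eq]

lemma vanishesMod_iff {N : ℕ} {h : Density I} :
    VanishesMod N h ↔ ∀ n < N, intx (derivD I) (h n) = 0 := by
  simp only [VanishesMod, intx_eq_zero_iff, dx_eq]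

lemma bracket_eq (A : BracketCoeffs I) (F G : Density I) :
    bracket A F G = jetBracket (derivD I) A F G := by
  ext1 n
  simp only [bracket, euler_eq, applyOp_eq]
  rfl

end SmoothFunctions

section CommutingHamiltonians

variable {I : TopologicalSpace.Opens ℝ} {A B : BracketCoeffs I} {H : SmoothFun I → Density I}
  {N : ℕ}

lemma IsGraded.jetGraded (hA : IsGraded A) : JetGraded A := fun k s hs =>
  ⟨k + 1 - s, by omega, (hA k s).1 (by omega)⟩

lemma isCommutingFamily_of_vanishesMod (hH : ∀ f, H f 0 = C f)
    (hAH : ∀ f g, VanishesMod N (bracket A (H f) (H g))) :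
    IsCommutingFamily (derivD I) A H N where
  leading := hH
  commute f g := by simpa only [vanishesMod_iff, bracket_eq] using hAH f g

lemma IsGraded.eq_of_commute (hI : IsConnected (I : Set ℝ)) (hA : IsGraded A) (hB : IsGraded B)
    (hH : ∀ f, H f 0 = C f) (hAH : ∀ f g, VanishesMod N (bracket A (H f) (H g)))
    (hBH : ∀ f g, VanishesMod N (bracket B (H f) (H g))) (h0 : A 0 = B 0) :
    ∀ k < N, A k = B k := by
  intro k hk
  ext1 s
  rcases le_or_gt s (k + 1) with hs | hs
  · exact (isCommutingFamily_of_vanishesMod hH hAH).bracketOp_eq smoothRealization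
      (exists_D_eq hI) (isCommutingFamily_of_vanishesMod hH hBH) hA.jetGraded hB.jetGraded
      h0 k hk s (by omega)
  · rw [(hA k s).2 hs, (hB k s).2 hs]

lemma IsGraded.isPoissonMod_of_commute (hI : IsConnected (I : Set ℝ)) (hA : IsGraded A)
    (hH : ∀ f, H f 0 = C f) (hAH : ∀ f g, VanishesMod N (bracket A (H f) (H g)))
    (skew_zero : ∀ f g : DiffPoly I, ∃ r, dx r = f * applyOp A 0 g + g * applyOp A 0 f) :
    IsPoissonMod N A := by
  have hcomm := isCommutingFamily_of_vanishesMod hH hAH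
  have isSkewOp_zero : IsSkewOp (derivD I) (bracketOp (derivD I) A 0) := fun f g => by
    simpa only [intx_eq_zero_iff, dx_eq, applyOp_eq] using skew_zero f g
  simp only [IsPoissonMod, vanishesMod_iff, bracket_eq]
  exact ⟨fun F G n hn => hcomm.intx_jetBracket_add_eq_zero smoothRealization (exists_D_eq hI)
      hA.jetGraded isSkewOp_zero F G hn,
    fun F G K n hn => hcomm.intx_jacobi_eq_zero smoothRealization (exists_D_eq hI)
      hA.jetGraded isSkewOp_zero F G K hn⟩

end CommutingHamiltonians
/-! ## Differential polynomials of low degree -/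

section LowDegree

variable {S : Type*} [CommRing S]

/-- The general differential polynomial of degree `1`. -/
def linear (a₁ : S) : JetPoly S := C a₁ * X 0

/-- The general differential polynomial of degree `2`; as in all these normal forms, the digits in
the index of a coefficient list the derivatives of `u` in the monomial. -/
def quadratic (a₁₁ a₂ : S) : JetPoly S := C a₁₁ * X 0 ^ 2 + C a₂ * X 1

/-- The general differential polynomial of degree `3`. -/
def cubic (a₁₁₁ a₁₂ a₃ : S) : JetPoly S := C a₁₁₁ * X 0 ^ 3 + C a₁₂ * X 0 * X 1 + C a₃ * X 2

/-- The general differential polynomial of degree `4`. -/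
def quartic (a₁₁₁₁ a₁₁₂ a₂₂ a₁₃ a₄ : S) : JetPoly S :=
  C a₁₁₁₁ * X 0 ^ 4 + C a₁₁₂ * X 0 ^ 2 * X 1 + C a₂₂ * X 1 ^ 2 + C a₁₃ * X 0 * X 2 + C a₄ * X 3

/-- The general differential polynomial of degree `5`. -/
def quintic (a₁₁₁₁₁ a₁₁₁₂ a₁₂₂ a₁₁₃ a₂₃ a₁₄ a₅ : S) : JetPoly S :=
  C a₁₁₁₁₁ * X 0 ^ 5 + C a₁₁₁₂ * X 0 ^ 3 * X 1 + C a₁₂₂ * X 0 * X 1 ^ 2 + C a₁₁₃ * X 0 ^ 2 * X 2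
    + C a₂₃ * X 1 * X 2 + C a₁₄ * X 0 * X 3 + C a₅ * X 4

section Algebra

variable (a a₁ a₁₁ a₂ a₁₁₁ a₁₂ a₃ a₁₁₁₁ a₁₁₂ a₂₂ a₁₃ a₄ a₁₁₁₁₁ a₁₁₁₂ a₁₂₂ a₁₁₃ a₂₃ a₁₄ a₅ : S)
  (b b₁ b₁₁ b₂ b₁₁₁ b₁₂ b₃ b₁₁₁₁ b₁₁₂ b₂₂ b₁₃ b₄ b₁₁₁₁₁ b₁₁₁₂ b₁₂₂ b₁₁₃ b₂₃ b₁₄ b₅ : S)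

lemma linear_add : linear a₁ + linear b₁ = linear (a₁ + b₁) := by
  simp only [linear, C_add]
  ring

lemma cubic_add :
    cubic a₁₁₁ a₁₂ a₃ + cubic b₁₁₁ b₁₂ b₃ = cubic (a₁₁₁ + b₁₁₁) (a₁₂ + b₁₂) (a₃ + b₃) := by
  simp only [cubic, C_add]
  ring

lemma quartic_add :
    quartic a₁₁₁₁ a₁₁₂ a₂₂ a₁₃ a₄ + quartic b₁₁₁₁ b₁₁₂ b₂₂ b₁₃ b₄ =
      quartic (a₁₁₁₁ + b₁₁₁₁) (a₁₁₂ + b₁₁₂) (a₂₂ + b₂₂) (a₁₃ + b₁₃) (a₄ + b₄) := by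
  simp only [quartic, C_add]
  ring

lemma quintic_add :
    quintic a₁₁₁₁₁ a₁₁₁₂ a₁₂₂ a₁₁₃ a₂₃ a₁₄ a₅ + quintic b₁₁₁₁₁ b₁₁₁₂ b₁₂₂ b₁₁₃ b₂₃ b₁₄ b₅ =
      quintic (a₁₁₁₁₁ + b₁₁₁₁₁) (a₁₁₁₂ + b₁₁₁₂) (a₁₂₂ + b₁₂₂) (a₁₁₃ + b₁₁₃) (a₂₃ + b₂₃)
        (a₁₄ + b₁₄) (a₅ + b₅) := by
  simp only [quintic, C_add]
  ring

lemma C_mul_linear : C a * linear b₁ = linear (a * b₁) := by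
  simp only [linear, C_mul]
  ring

lemma linear_mul_C : linear a₁ * C b = linear (a₁ * b) := by
  simp only [linear, C_mul]
  ring

lemma C_mul_quadratic : C a * quadratic b₁₁ b₂ = quadratic (a * b₁₁) (a * b₂) := by
  simp only [quadratic, C_mul]
  ring

lemma C_mul_cubic : C a * cubic b₁₁₁ b₁₂ b₃ = cubic (a * b₁₁₁) (a * b₁₂) (a * b₃) := by
  simp only [cubic, C_mul]
  ring

lemma linear_mul_quadratic :
    linear a₁ * quadratic b₁₁ b₂ = cubic (a₁ * b₁₁) (a₁ * b₂) 0 := by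
  simp only [linear, quadratic, cubic, C_mul, C_0]
  ring

lemma quadratic_mul_linear :
    quadratic a₁₁ a₂ * linear b₁ = cubic (a₁₁ * b₁) (a₂ * b₁) 0 := by
  rw [mul_comm, linear_mul_quadratic, mul_comm, mul_comm b₁]

lemma cubic_mul_C : cubic a₁₁₁ a₁₂ a₃ * C b = cubic (a₁₁₁ * b) (a₁₂ * b) (a₃ * b) := by
  simp only [cubic, C_mul]
  ring

lemma C_mul_quartic :
    C a * quartic b₁₁₁₁ b₁₁₂ b₂₂ b₁₃ b₄ =
      quartic (a * b₁₁₁₁) (a * b₁₁₂) (a * b₂₂) (a * b₁₃) (a * b₄) := by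
  simp only [quartic, C_mul]
  ring

lemma C_mul_quintic :
    C a * quintic b₁₁₁₁₁ b₁₁₁₂ b₁₂₂ b₁₁₃ b₂₃ b₁₄ b₅ =
      quintic (a * b₁₁₁₁₁) (a * b₁₁₁₂) (a * b₁₂₂) (a * b₁₁₃) (a * b₂₃) (a * b₁₄) (a * b₅) := by
  simp only [quintic, C_mul]
  ring

lemma linear_mul_quartic :
    linear a₁ * quartic b₁₁₁₁ b₁₁₂ b₂₂ b₁₃ b₄ =
      quintic (a₁ * b₁₁₁₁) (a₁ * b₁₁₂) (a₁ * b₂₂) (a₁ * b₁₃) 0 (a₁ * b₄) 0 := by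
  simp only [linear, quartic, quintic, C_mul, C_0]
  ring

lemma quadratic_mul_cubic :
    quadratic a₁₁ a₂ * cubic b₁₁₁ b₁₂ b₃ =
      quintic (a₁₁ * b₁₁₁) (a₁₁ * b₁₂ + a₂ * b₁₁₁) (a₂ * b₁₂) (a₁₁ * b₃) (a₂ * b₃) 0 0 := by
  simp only [quadratic, cubic, quintic, C_add, C_mul, C_0]
  ring

lemma cubic_mul_quadratic :
    cubic a₁₁₁ a₁₂ a₃ * quadratic b₁₁ b₂ =
      quintic (a₁₁₁ * b₁₁) (a₁₁₁ * b₂ + a₁₂ * b₁₁) (a₁₂ * b₂) (a₃ * b₁₁) (a₃ * b₂) 0 0 := by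
  simp only [quadratic, cubic, quintic, C_add, C_mul, C_0]
  ring

lemma quartic_mul_linear :
    quartic a₁₁₁₁ a₁₁₂ a₂₂ a₁₃ a₄ * linear b₁ =
      quintic (a₁₁₁₁ * b₁) (a₁₁₂ * b₁) (a₂₂ * b₁) (a₁₃ * b₁) 0 (a₄ * b₁) 0 := by
  simp only [linear, quartic, quintic, C_mul, C_0]
  ring

lemma quintic_mul_C :
    quintic a₁₁₁₁₁ a₁₁₁₂ a₁₂₂ a₁₁₃ a₂₃ a₁₄ a₅ * C b =
      quintic (a₁₁₁₁₁ * b) (a₁₁₁₂ * b) (a₁₂₂ * b) (a₁₁₃ * b) (a₂₃ * b) (a₁₄ * b) (a₅ * b) := by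
  simp only [quintic, C_mul]
  ring

end Algebra

section TotalDerivative

variable {R : Type*} [CommRing R] [Algebra R S] (δ : Derivation R S S)
  (a a₁ a₁₁ a₂ a₁₁₁ a₁₂ a₃ a₁₁₁₁ a₁₁₂ a₂₂ a₁₃ a₄ : S)

lemma totalDeriv_C_eq_linear : totalDeriv δ (C a) = linear (δ a) := by
  rw [totalDeriv_C, linear, mul_comm]

lemma totalDeriv_linear : totalDeriv δ (linear a₁) = quadratic (δ a₁) a₁ := by
  simp only [linear, quadratic, Derivation.leibniz, totalDeriv_C, totalDeriv_X, smul_eq_mul]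
  ring

lemma totalDeriv_quadratic :
    totalDeriv δ (quadratic a₁₁ a₂) = cubic (δ a₁₁) (δ a₂ + 2 * a₁₁) a₂ := by
  simp only [quadratic, cubic, map_add (totalDeriv δ), Derivation.leibniz, Derivation.leibniz_pow,
    totalDeriv_C, totalDeriv_X, smul_eq_mul, nsmul_eq_mul, C_add, C_mul, map_ofNat]
  push_cast
  ring

lemma totalDeriv_cubic :
    totalDeriv δ (cubic a₁₁₁ a₁₂ a₃) =
      quartic (δ a₁₁₁) (δ a₁₂ + 3 * a₁₁₁) a₁₂ (δ a₃ + a₁₂) a₃ := by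
  simp only [cubic, quartic, map_add (totalDeriv δ), Derivation.leibniz, Derivation.leibniz_pow,
    totalDeriv_C, totalDeriv_X, smul_eq_mul, nsmul_eq_mul, C_add, C_mul, map_ofNat]
  push_cast
  ring

lemma totalDeriv_quartic :
    totalDeriv δ (quartic a₁₁₁₁ a₁₁₂ a₂₂ a₁₃ a₄) =
      quintic (δ a₁₁₁₁) (δ a₁₁₂ + 4 * a₁₁₁₁) (δ a₂₂ + 2 * a₁₁₂) (δ a₁₃ + a₁₁₂) (a₁₃ + 2 * a₂₂)
        (δ a₄ + a₁₃) a₄ := by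
  simp only [quartic, quintic, map_add (totalDeriv δ), Derivation.leibniz, Derivation.leibniz_pow,
    totalDeriv_C, totalDeriv_X, smul_eq_mul, nsmul_eq_mul, C_add, C_mul, map_ofNat]
  push_cast
  ring

end TotalDerivative

section Exactness

variable {K : Type*} [Field K] [CharZero K] [Algebra K S] (δ : Derivation K S S)

variable (K) in
lemma ofNat_mul_inv_smul (n : ℕ) [n.AtLeastTwo] (x : S) :
    ofNat(n) * ((ofNat(n) : K)⁻¹ • x) = x := by
  rw [← map_ofNat (algebraMap K S), ← Algebra.smul_def, smul_inv_smul₀ (OfNat.ofNat_ne_zero n)]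

lemma exists_totalDeriv_eq_cubic {a₁₁₁ a₁₂ a₃ : S} (h : 2 * a₁₁₁ = δ (a₁₂ - δ a₃)) :
    ∃ r, totalDeriv δ r = cubic a₁₁₁ a₁₂ a₃ := by
  refine ⟨quadratic ((2⁻¹ : K) • (a₁₂ - δ a₃)) a₃, ?_⟩
  rw [totalDeriv_quadratic, δ.map_smul, ← h, ← mul_smul_comm, ofNat_mul_inv_smul K,
    ofNat_mul_inv_smul K, add_sub_cancel]

lemma exists_totalDeriv_eq_quintic {a₁₁₁₁₁ a₁₁₁₂ a₁₂₂ a₁₁₃ a₂₃ a₁₄ a₅ b₁₃ b₁₁₂ : S}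
    (h₁₄ : a₁₄ = δ a₅ + b₁₃) (h₁₁₃ : a₁₁₃ = δ b₁₃ + b₁₁₂)
    (h₁₂₂ : 2 * a₁₂₂ = δ (a₂₃ - b₁₃) + 4 * b₁₁₂)
    (h₁₁₁₁₁ : 4 * a₁₁₁₁₁ = δ (a₁₁₁₂ - δ b₁₁₂)) :
    ∃ r, totalDeriv δ r = quintic a₁₁₁₁₁ a₁₁₁₂ a₁₂₂ a₁₁₃ a₂₃ a₁₄ a₅ := by
  have coeff₁₂₂ : (2⁻¹ : K) • δ (a₂₃ - b₁₃) + 2 * b₁₁₂ = a₁₂₂ := by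
    rw [eq_sub_of_add_eq h₁₂₂.symm, show 2 * a₁₂₂ - 4 * b₁₁₂ = 2 * (a₁₂₂ - 2 * b₁₁₂) by ring,
      ← mul_smul_comm, ofNat_mul_inv_smul K, sub_add_cancel]
  refine ⟨quartic ((4⁻¹ : K) • (a₁₁₁₂ - δ b₁₁₂)) b₁₁₂ ((2⁻¹ : K) • (a₂₃ - b₁₃)) b₁₃ a₅, ?_⟩
  rw [totalDeriv_quartic, δ.map_smul, δ.map_smul, coeff₁₂₂, ← h₁₁₁₁₁, ← h₁₁₃, ← h₁₄,
    ← mul_smul_comm, ofNat_mul_inv_smul K, ofNat_mul_inv_smul K, ofNat_mul_inv_smul K,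
    add_sub_cancel, add_sub_cancel]

end Exactness

section VariationalDerivative

variable {R : Type*} [CommRing R] [Algebra R S] (δ : Derivation R S S) (a : S)

lemma jetOrder_C_mul_X_pow_le (k n : ℕ) : jetOrder (C a * X k ^ n : JetPoly S) ≤ k + 2 := by
  classical
  refine Nat.succ_le_succ (Finset.sup_le fun i hi => ?_)
  obtain hS | hS := subsingleton_or_nontrivial S
  · rw [Subsingleton.elim (C a * X k ^ n) 0, vars_0] at hi
    exact absurd hi (Finset.notMem_empty i)
  have hi' := (vars_pow _ _) ((vars_mul _ _).trans (by rw [vars_C, Finset.empty_union]) hi)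
  rw [vars_X, Finset.mem_singleton] at hi'
  omega

lemma jetEuler_C_mul_X_zero_sq :
    jetEuler δ (C a * X 0 ^ 2) = quadratic (-δ a) (-(2 * a)) := by
  rw [jetEuler_eq_sum δ _ (jetOrder_C_mul_X_pow_le a 0 2)]
  simp only [Finset.sum_range_succ, Finset.sum_range_zero, jetPartial_zero, jetPartial_succ_apply,
    totalPow_zero, totalPow_succ, Derivation.leibniz, Derivation.leibniz_pow, coeffDerivation_C,
    coeffDerivation_X, pderiv_C, pderiv_X_self, totalDeriv_C, totalDeriv_X,
    Derivation.map_one_eq_zero, Derivation.map_natCast, smul_eq_mul, nsmul_eq_mul, map_add,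
    map_zero, Nat.add_one_sub_one, pow_one, quadratic, C_neg, C_mul, map_ofNat]
  push_cast
  ring

lemma jetEuler_C_mul_X_zero_pow_four :
    jetEuler δ (C a * X 0 ^ 4) = quartic (-(3 * δ a)) (-(12 * a)) 0 0 0 := by
  rw [jetEuler_eq_sum δ _ (jetOrder_C_mul_X_pow_le a 0 4)]
  simp only [Finset.sum_range_succ, Finset.sum_range_zero, jetPartial_zero, jetPartial_succ_apply,
    totalPow_zero, totalPow_succ, Derivation.leibniz, Derivation.leibniz_pow, coeffDerivation_C,
    coeffDerivation_X, pderiv_C, pderiv_X_self, totalDeriv_C, totalDeriv_X,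
    Derivation.map_one_eq_zero, Derivation.map_natCast, smul_eq_mul, nsmul_eq_mul, map_add,
    map_zero, Nat.add_one_sub_one, pow_one, quartic, C_neg, C_mul, map_ofNat]
  push_cast
  ring

lemma jetEuler_C_mul_X_one_sq :
    jetEuler δ (C a * X 1 ^ 2) = quartic 0 (2 * δ (δ a)) (3 * δ a) (4 * δ a) (2 * a) := by
  rw [jetEuler_eq_sum δ _ (jetOrder_C_mul_X_pow_le a 1 2)]
  simp only [Finset.sum_range_succ, Finset.sum_range_zero, jetPartial_zero, jetPartial_succ_apply,
    totalPow_zero, totalPow_succ, Derivation.leibniz, Derivation.leibniz_pow, coeffDerivation_C,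
    coeffDerivation_X, pderiv_C, pderiv_X_self, pderiv_X_of_ne (one_ne_zero : (1 : ℕ) ≠ 0),
    totalDeriv_C, totalDeriv_X, Derivation.map_one_eq_zero, Derivation.map_natCast, smul_eq_mul,
    nsmul_eq_mul, map_add, map_zero, Nat.add_one_sub_one, pow_one, quartic, C_mul, map_ofNat]
  push_cast
  ring

lemma jetEuler_neg_C_mul_X_zero_sq :
    jetEuler δ (-C a * X 0 ^ 2) = quadratic (δ a) (2 * a) := by
  rw [← C_neg, jetEuler_C_mul_X_zero_sq, map_neg, neg_neg, mul_neg, neg_neg]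

lemma jetEuler_C_mul_X_one_sq_sub (b : S) :
    jetEuler δ (C a * X 1 ^ 2 - C b * X 0 ^ 4) =
      quartic (3 * δ b) (2 * δ (δ a) + 12 * b) (3 * δ a) (4 * δ a) (2 * a) := by
  rw [sub_eq_add_neg, ← neg_mul, ← C_neg, jetEuler_add, jetEuler_C_mul_X_one_sq,
    jetEuler_C_mul_X_zero_pow_four, quartic_add, map_neg, mul_neg, mul_neg, neg_neg, neg_neg]
  simp only [zero_add, add_zero]

end VariationalDerivative

end LowDegree
/-! ## The Hamiltonians and the bihamiltonian recursion -/

section Hamiltonians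

variable {I : TopologicalSpace.Opens ℝ}

lemma D_one : D (1 : SmoothFun I) = 0 := (derivD I).map_one_eq_zero

lemma D_ofNat (n : ℕ) [n.AtLeastTwo] : D (ofNat(n) : SmoothFun I) = 0 :=
  (derivD I).map_natCast n

lemma D_sub (f g : SmoothFun I) : D (f - g) = D f - D g := map_sub (derivD I) f g

lemma D_sq (f : SmoothFun I) : D (f ^ 2) = 2 * (f * D f) := by
  rw [sq, D_mul, two_mul]

lemma evalFun_ext {f g : SmoothFun I} (h : ∀ x, evalFun x f = evalFun x g) : f = g :=
  smoothFun_ext h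

lemma evalFun_smul (a : ℝ) (f : SmoothFun I) (x : I) : evalFun x (a • f) = a * evalFun x f := rfl

lemma recip_mul_self (f : SmoothFun I) (hf : ∀ x, f.1 x ≠ 0) : recip f hf * f = 1 :=
  evalFun_ext fun x => inv_mul_cancel₀ (hf x)

/-- The coefficient of `u_{xx}²` in the term of order `ε⁴` of `h_f`. -/
def hamCoeff₂₂ (c p f : SmoothFun I) : SmoothFun I :=
  p * D^[3] f + (1 / 480 : ℝ) • (c ^ 2 * D^[4] f)

/-- The opposite of the coefficient of `u_x⁴` in the term of order `ε⁴` of `h_f`. -/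
def hamCoeff₁₁₁₁ (c p f : SmoothFun I) : SmoothFun I :=
  (1 / 1152 : ℝ) • (c * D^[2] c * D^[4] f) + (1 / 1152 : ℝ) • (c * D c * D^[5] f)
    + (1 / 3456 : ℝ) • (c ^ 2 * D^[6] f) + (1 / 6 : ℝ) • (D p * D^[4] f)
    + (1 / 6 : ℝ) • (p * D^[5] f)

/-- The variational derivative of `H_f`, order by order in `ε`. -/
def hamGradient (c p f : SmoothFun I) : Density I
  | 0 => C (D f)
  | 2 => quadratic (D ((1 / 24 : ℝ) • (c * D^[3] f))) (2 * (1 / 24 : ℝ) • (c * D^[3] f))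
  | 4 => quartic (3 * D (hamCoeff₁₁₁₁ c p f))
      (2 * D (D (hamCoeff₂₂ c p f)) + 12 * hamCoeff₁₁₁₁ c p f) (3 * D (hamCoeff₂₂ c p f))
      (4 * D (hamCoeff₂₂ c p f)) (2 * hamCoeff₂₂ c p f)
  | _ => 0

lemma euler_hamDensity (c p f : SmoothFun I) (n : ℕ) :
    euler (hamDensity c p 0 f n) = hamGradient c p f n := by
  rw [euler_eq]
  match n with
  | 0 => exact jetEuler_C _ f
  | 2 => exact jetEuler_neg_C_mul_X_zero_sq (derivD I) _
  | 4 =>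
    have density_eq : hamDensity c p 0 f 4 =
        C (hamCoeff₂₂ c p f) * X 1 ^ 2 - C (hamCoeff₁₁₁₁ c p f - 0 * D^[3] f) * X 0 ^ 4 := rfl
    rw [density_eq, zero_mul, sub_zero]
    exact jetEuler_C_mul_X_one_sq_sub (derivD I) _ _
  | 1 => exact jetEuler_zero _
  | 3 => exact jetEuler_zero _
  | _ + 5 => exact jetEuler_zero _

lemma dx_zero : dx (0 : DiffPoly I) = 0 := by
  rw [dx_eq, map_zero]

section FirstBracket

variable (c p f g : SmoothFun I)

lemma exists_dx_eq_hamGradient_mul_dx_two :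
    ∃ r, dx r = hamGradient c p f 0 * dx (hamGradient c p g 2)
      + hamGradient c p f 2 * dx (hamGradient c p g 0) := by
  simp only [hamGradient, dx_eq, totalDeriv_C_eq_linear, totalDeriv_quadratic, derivD_apply,
    quadratic_mul_linear, C_mul_cubic, cubic_add]
  refine exists_totalDeriv_eq_cubic (derivD I) (evalFun_ext fun x => ?_)
  simp only [derivD_apply, Function.iterate_succ_apply, Function.iterate_zero_apply, D_add,
    D_mul, D_smul, D_ofNat, mul_zero, add_zero, map_add, map_sub, map_mul, map_ofNat, evalFun_smul]
  ring

set_option maxHeartbeats 1000000 in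
-- seven coefficients, each a polynomial in the derivatives of `c`, `p`, `f` and `g`
lemma exists_dx_eq_hamGradient_mul_dx_four :
    ∃ r, dx r = hamGradient c p f 0 * dx (hamGradient c p g 4)
      + hamGradient c p f 2 * dx (hamGradient c p g 2)
      + hamGradient c p f 4 * dx (hamGradient c p g 0) := by
  simp only [hamGradient, dx_eq, totalDeriv_C_eq_linear, totalDeriv_quadratic, totalDeriv_quartic,
    derivD_apply, quartic_mul_linear, quadratic_mul_cubic, C_mul_quintic, quintic_add]
  refine exists_totalDeriv_eq_quintic (derivD I) (eq_add_of_sub_eq' rfl) (eq_add_of_sub_eq' rfl)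
    (evalFun_ext fun x => ?_) (evalFun_ext fun x => ?_)
  all_goals
    simp only [derivD_apply, hamCoeff₂₂, hamCoeff₁₁₁₁, Function.iterate_succ_apply,
      Function.iterate_zero_apply, D_add, D_mul, D_sq, D_smul, D_ofNat, mul_zero,
      add_zero, map_add, map_sub, map_mul, map_pow, map_ofNat, evalFun_smul]
    ring

lemma exists_dx_eq_sum_hamGradient_mul_dx (hI : IsConnected (I : Set ℝ)) {n : ℕ} (hn : n < 6) :
    ∃ r, dx r = ∑ a ∈ antidiagonal n, hamGradient c p f a.1 * dx (hamGradient c p g a.2) := by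
  have odd_eq_zero (h : SmoothFun I) : hamGradient c p h 1 = 0 ∧ hamGradient c p h 3 = 0 ∧
      hamGradient c p h 5 = 0 := ⟨rfl, rfl, rfl⟩
  interval_cases n <;>
    simp only [Finset.Nat.sum_antidiagonal_eq_sum_range_succ_mk, Finset.sum_range_succ,
      Finset.sum_range_zero, Nat.reduceSub, Nat.sub_zero, odd_eq_zero, dx_zero,
      zero_mul, mul_zero, add_zero, zero_add]
  · obtain ⟨φ, hφ⟩ := exists_D_eq hI (D f * D (D g))
    refine ⟨C φ, ?_⟩
    simp only [hamGradient, dx_eq, totalDeriv_C_eq_linear, derivD_apply, hφ, C_mul_linear]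
  · exact ⟨0, dx_zero⟩
  · exact exists_dx_eq_hamGradient_mul_dx_two c p f g
  · exact ⟨0, dx_zero⟩
  · exact exists_dx_eq_hamGradient_mul_dx_four c p f g
  · exact ⟨0, dx_zero⟩

end FirstBracket

section SecondBracket

variable {c p g q t w : SmoothFun I}

lemma applyOp_of_eq_zero {A : BracketCoeffs I} {k : ℕ} (hA : A k = 0) (h : DiffPoly I) :
    applyOp A k h = 0 := by
  rw [applyOp, hA]
  exact Finset.sum_eq_zero fun s _ => zero_mul _

lemma applyOp_zero (A : BracketCoeffs I) (k : ℕ) : applyOp A k 0 = 0 := by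
  rw [applyOp_eq, map_zero]

lemma applyOp_secondBracket_hamGradient_zero (hq : ∀ x, (D q).1 x ≠ 0)
    (ht : D (D t) = q * D (D g) + (1 / 2 : ℝ) • (D q * D g)) :
    applyOp (secondBracket c q hq) 0 (hamGradient c p g 0) = dx (hamGradient c p t 0) := by
  simp only [applyOp, Finset.sum_range_succ, Finset.sum_range_zero, zero_add,
    Function.iterate_succ_apply', Function.iterate_zero_apply]
  change linear _ * _ + C _ * _ = _
  simp only [hamGradient, dx_eq, totalDeriv_C_eq_linear, derivD_apply, linear_mul_C, C_mul_linear,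
    linear_add, ht]
  rw [add_comm, smul_mul_assoc]

lemma applyOp_secondBracket_hamGradient_two (hq : ∀ x, (D q).1 x ≠ 0)
    (ht : D (D t) = q * D (D g) + (1 / 2 : ℝ) • (D q * D g)) :
    applyOp (secondBracket c q hq) 0 (hamGradient c p g 2)
      + applyOp (secondBracket c q hq) 2 (hamGradient c p g 0) = dx (hamGradient c p t 2) := by
  simp only [applyOp, Finset.sum_range_succ, Finset.sum_range_zero, zero_add,
    Function.iterate_succ_apply', Function.iterate_zero_apply]
  change linear _ * _ + C _ * _ + (cubic _ _ _ * _ + quadratic _ _ * _ + linear _ * _ + C _ * _) = _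
  simp only [hamGradient, dx_eq, totalDeriv_C_eq_linear, totalDeriv_linear, totalDeriv_quadratic,
    derivD_apply, cubic_mul_C, quadratic_mul_linear, linear_mul_quadratic, C_mul_cubic, cubic_add]
  congr 1 <;> refine evalFun_ext fun x => ?_ <;>
    simp only [Function.iterate_succ_apply, Function.iterate_zero_apply, D_add, D_mul, D_smul,
      D_ofNat, mul_zero, add_zero, ht, map_add, map_mul, map_ofNat, map_zero, evalFun_smul] <;>
    ring

/-- The operator `∂ + w`, i.e. `∂` conjugated by a function with logarithmic derivative `w`; it
produces the ratios `q⁽ⁿ⁺¹⁾ / q'` from `w = q'' / q'`. -/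
def twistedD (w f : SmoothFun I) : SmoothFun I := D f + w * f

lemma D_iterate_mul (hw : D q = q * w) (n : ℕ) (f : SmoothFun I) :
    D^[n] (q * f) = q * (twistedD w)^[n] f := by
  induction n generalizing f with
  | zero => rfl
  | succ n ih =>
    rw [Function.iterate_succ_apply, Function.iterate_succ_apply, ← ih, D_mul, hw, twistedD]
    ring_nf

set_option maxHeartbeats 2000000 in
-- nineteen coefficients, of up to thirty-odd terms each
lemma orderFourTerm_mul {a b : SmoothFun I} (hab : b * a = 1)
    (c c1 c2 c3 c4 q1 q2 q3 q4 q5 q6 q7 r : SmoothFun I) (s : ℕ) :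
    orderFourTerm c c1 c2 c3 c4 (a * q1) (a * q2) (a * q3) (a * q4) (a * q5) (a * q6) (a * q7)
      (b * r) s = C a * orderFourTerm c c1 c2 c3 c4 q1 q2 q3 q4 q5 q6 q7 r s := by
  rcases s with _ | _ | _ | _ | _ | _ | _
  on_goal 1 =>
    change quintic _ _ _ _ _ _ _ = C a * quintic _ _ _ _ _ _ _
    rw [C_mul_quintic]
  on_goal 2 =>
    change quartic _ _ _ _ _ = C a * quartic _ _ _ _ _
    rw [C_mul_quartic]
  on_goal 3 =>
    change cubic _ _ _ = C a * cubic _ _ _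
    rw [C_mul_cubic]
  on_goal 4 =>
    change quadratic _ _ = C a * quadratic _ _
    rw [C_mul_quadratic]
  on_goal 5 =>
    change linear _ = C a * linear _
    rw [C_mul_linear]
  on_goal 6 =>
    change C _ = C a * C _
    rw [← C_mul]
  on_goal 7 => exact (mul_zero _).symm
  all_goals
    congr 1 <;> refine evalFun_ext fun x => ?_
    all_goals
      have hb : evalFun x b * evalFun x a = 1 := by rw [← map_mul, hab, map_one]
      have ha := right_ne_zero_of_mul_eq_one hb
      simp only [k5, k4_1, k3_11, k3_2, k2_111, k2_1_2, k2_3, k1_1111, k1_11_2, k1_22, k1_1_3, k1_4,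
      k0_11111, k0_111_2, k0_1_22, k0_11_3, k0_2_3, k0_1_4, k0_5, map_add,
        map_sub, map_mul, map_pow, evalFun_smul, eq_inv_of_mul_eq_one_left hb]
      field_simp

lemma secondBracket_four (hq : ∀ x, (D q).1 x ≠ 0) (hw : D (D q) = D q * w) (s : ℕ) :
    secondBracket c q hq 4 s = C (D q) * orderFourTerm c (D c) (D^[2] c) (D^[3] c) (D^[4] c) 1
      ((twistedD w)^[1] 1) ((twistedD w)^[2] 1) ((twistedD w)^[3] 1) ((twistedD w)^[4] 1)
      ((twistedD w)^[5] 1) ((twistedD w)^[6] 1) 1 s := by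
  have D_iterate_eq (n : ℕ) : D^[n + 1] q = D q * (twistedD w)^[n] 1 := by
    rw [Function.iterate_succ_apply, ← D_iterate_mul hw, mul_one]
  rw [← orderFourTerm_mul (recip_mul_self (D q) hq), mul_one, mul_one]
  simp only [← D_iterate_eq]
  rfl

set_option maxHeartbeats 2000000 in
-- seven coefficients, each a polynomial in the derivatives of `c`, `q`, `w` and `g`
lemma applyOp_secondBracket_hamGradient_four (hq : ∀ x, (D q).1 x ≠ 0) (hw : D (D q) = D q * w)
    (hp : p = (1 / 192 : ℝ) • (c * D c) - (1 / 960 : ℝ) • (c ^ 2 * w))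
    (ht : D (D t) = q * D (D g) + (1 / 2 : ℝ) • (D q * D g)) :
    applyOp (secondBracket c q hq) 0 (hamGradient c p g 4)
      + applyOp (secondBracket c q hq) 2 (hamGradient c p g 2)
      + applyOp (secondBracket c q hq) 4 (hamGradient c p g 0) = dx (hamGradient c p t 4) := by
  simp only [applyOp, Finset.sum_range_succ, Finset.sum_range_zero, zero_add,
    Function.iterate_succ_apply', Function.iterate_zero_apply, secondBracket_four hq hw]
  change linear _ * _ + C _ * _
    + (cubic _ _ _ * _ + quadratic _ _ * _ + linear _ * _ + C _ * _)
    + (C _ * quintic _ _ _ _ _ _ _ * _ + C _ * quartic _ _ _ _ _ * _ + C _ * cubic _ _ _ * _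
      + C _ * quadratic _ _ * _ + C _ * linear _ * _ + C _ * C _ * _) = _
  simp only [hamGradient, dx_eq, totalDeriv_C_eq_linear, totalDeriv_linear, totalDeriv_quadratic,
    totalDeriv_cubic, totalDeriv_quartic, derivD_apply, linear_mul_quartic, C_mul_quintic,
    C_mul_quartic, C_mul_cubic, C_mul_quadratic, C_mul_linear, ← C_mul, cubic_mul_quadratic,
    quadratic_mul_cubic, quintic_mul_C, quartic_mul_linear, quintic_add]
  subst hp
  congr 1 <;> refine evalFun_ext fun x => ?_
  all_goals
    simp only [k5, k4_1, k3_11, k3_2, k2_111, k2_1_2, k2_3, k1_1111, k1_11_2, k1_22, k1_1_3, k1_4,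
      k0_11111, k0_111_2, k0_1_22, k0_11_3, k0_2_3, k0_1_4, k0_5, hamCoeff₂₂, hamCoeff₁₁₁₁,
      Function.iterate_succ_apply, Function.iterate_zero_apply, D_add, D_mul, D_smul, D_sub, D_sq,
      D_ofNat, D_one, twistedD, ht, hw, one_pow, mul_one, mul_zero, add_zero, zero_add]
    simp only [map_add, map_sub, map_mul, map_pow, map_ofNat, evalFun_smul]
    ring

lemma sum_applyOp_secondBracket_hamGradient (hq : ∀ x, (D q).1 x ≠ 0)
    (hp : ∀ x, p.1 x = (5 * c.1 x * (D c).1 x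
      - (c.1 x) ^ 2 * ((D^[2] q).1 x / (D q).1 x)) / 960)
    (ht : D (D t) = q * D (D g) + (1 / 2 : ℝ) • (D q * D g)) {m : ℕ} (hm : m < 6) :
    ∑ b ∈ antidiagonal m, applyOp (secondBracket c q hq) b.1 (hamGradient c p g b.2) =
      dx (hamGradient c p t m) := by
  have hw : D (D q) = D q * (D (D q) * recip (D q) hq) := by
    rw [mul_left_comm, mul_comm (D q), recip_mul_self, mul_one]
  have hp' : p = (1 / 192 : ℝ) • (c * D c)
      - (1 / 960 : ℝ) • (c ^ 2 * (D (D q) * recip (D q) hq)) := by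
    ext x
    refine (hp x).trans ?_
    change _ = 1 / 192 * (c.1 x * (D c).1 x)
      - 1 / 960 * (c.1 x ^ 2 * ((D^[2] q).1 x * ((D q).1 x)⁻¹))
    ring
  have gradient_odd (h : SmoothFun I) : hamGradient c p h 1 = 0 ∧ hamGradient c p h 3 = 0 ∧
      hamGradient c p h 5 = 0 := ⟨rfl, rfl, rfl⟩
  have bracket_one := applyOp_of_eq_zero (A := secondBracket c q hq) (k := 1) rfl
  have bracket_three := applyOp_of_eq_zero (A := secondBracket c q hq) (k := 3) rfl
  have bracket_five := applyOp_of_eq_zero (A := secondBracket c q hq) (k := 5) rfl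
  interval_cases m <;>
    simp only [Finset.Nat.sum_antidiagonal_eq_sum_range_succ_mk, Finset.sum_range_succ,
      Finset.sum_range_zero, Nat.reduceSub, Nat.sub_zero, gradient_odd, bracket_one,
      bracket_three, bracket_five, applyOp_zero, dx_zero, add_zero, zero_add]
  · exact applyOp_secondBracket_hamGradient_zero hq ht
  · exact applyOp_secondBracket_hamGradient_two hq ht
  · exact applyOp_secondBracket_hamGradient_four hq hw hp' ht

end SecondBracket

end Hamiltonians

/-! ## The two brackets -/

section Grading

variable {S : Type*} [CommRing S]

lemma jetHomog_C_mul_X_pow (a : S) (i m : ℕ) : JetHomog (C a * X i ^ m) (m * (i + 1)) :=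
  ((jetHomog_C a).mul ((jetHomog_X i).pow m)).of_eq (zero_add _)

lemma JetHomog.mul_X_pow {h : JetPoly S} {d : ℕ} (hh : JetHomog h d) (i m : ℕ) :
    JetHomog (h * X i ^ m) (d + m * (i + 1)) :=
  hh.mul ((jetHomog_X i).pow m)

lemma JetHomog.mul_X {h : JetPoly S} {d : ℕ} (hh : JetHomog h d) (i : ℕ) :
    JetHomog (h * X i) (d + (i + 1)) :=
  hh.mul (jetHomog_X i)

lemma jetHomog_C_mul_X (a : S) (i : ℕ) : JetHomog (C a * X i) (i + 1) :=
  ((jetHomog_C a).mul_X i).of_eq (zero_add _)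

lemma jetHomog_linear (a₁ : S) : JetHomog (linear a₁) 1 := jetHomog_C_mul_X a₁ 0

lemma jetHomog_quadratic (a₁₁ a₂ : S) : JetHomog (quadratic a₁₁ a₂) 2 :=
  (jetHomog_C_mul_X_pow a₁₁ 0 2).add (jetHomog_C_mul_X a₂ 1)

lemma jetHomog_cubic (a₁₁₁ a₁₂ a₃ : S) : JetHomog (cubic a₁₁₁ a₁₂ a₃) 3 :=
  ((jetHomog_C_mul_X_pow a₁₁₁ 0 3).add ((jetHomog_C_mul_X a₁₂ 0).mul_X 1)).add
    (jetHomog_C_mul_X a₃ 2)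

lemma jetHomog_quartic (a₁₁₁₁ a₁₁₂ a₂₂ a₁₃ a₄ : S) :
    JetHomog (quartic a₁₁₁₁ a₁₁₂ a₂₂ a₁₃ a₄) 4 :=
  ((((jetHomog_C_mul_X_pow a₁₁₁₁ 0 4).add ((jetHomog_C_mul_X_pow a₁₁₂ 0 2).mul_X 1)).add
    (jetHomog_C_mul_X_pow a₂₂ 1 2)).add ((jetHomog_C_mul_X a₁₃ 0).mul_X 2)).add
    (jetHomog_C_mul_X a₄ 3)

lemma jetHomog_quintic (a₁₁₁₁₁ a₁₁₁₂ a₁₂₂ a₁₁₃ a₂₃ a₁₄ a₅ : S) :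
    JetHomog (quintic a₁₁₁₁₁ a₁₁₁₂ a₁₂₂ a₁₁₃ a₂₃ a₁₄ a₅) 5 :=
  ((((((jetHomog_C_mul_X_pow a₁₁₁₁₁ 0 5).add ((jetHomog_C_mul_X_pow a₁₁₁₂ 0 3).mul_X 1)).add
    ((jetHomog_C_mul_X a₁₂₂ 0).mul_X_pow 1 2)).add ((jetHomog_C_mul_X_pow a₁₁₃ 0 2).mul_X 2)).add
    ((jetHomog_C_mul_X a₂₃ 1).mul_X 2)).add ((jetHomog_C_mul_X a₁₄ 0).mul_X 3)).add
    (jetHomog_C_mul_X a₅ 4)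

end Grading

section JetPencil

variable {R S : Type*} [CommRing R] [CommRing S] [Algebra R S]

lemma sub_smul_zero (h : JetPoly S) (r : R) : h - r • (0 : JetPoly S) = h := by
  rw [smul_zero, sub_zero]

lemma C_sub_smul_one (a : S) (r : R) : C a - r • (1 : JetPoly S) = C (a - r • 1) := by
  rw [C_sub, ← Algebra.algebraMap_eq_smul_one, ← Algebra.algebraMap_eq_smul_one,
    MvPolynomial.algebraMap_apply]

lemma jetBracket_pencil (δ : Derivation R S S) (A₁ A₂ : ℕ → ℕ → JetPoly S) (r : R)
    (F G : ℕ → JetPoly S) (n : ℕ) :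
    jetBracket δ (fun k s => A₂ k s - r • A₁ k s) F G n =
      jetBracket δ A₂ F G n - r • jetBracket δ A₁ F G n := by
  simp only [jetBracket, bracketOp, diffOp_apply, sub_mul, smul_mul_assoc, Finset.sum_sub_distrib,
    mul_sub, ← Finset.smul_sum, mul_smul_comm]

end JetPencil

section Pencil

variable {I : TopologicalSpace.Opens ℝ} {c p q : SmoothFun I}

lemma isHomog_zero (d : ℕ) : IsHomog (0 : DiffPoly I) d := isWeightedHomogeneous_zero ..

lemma isHomog_leadingTerm (q : SmoothFun I) : ∀ s, IsHomog (leadingTerm q s) (1 - s)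
  | 0 => jetHomog_linear _
  | 1 => jetHomog_C q
  | _ + 2 => isHomog_zero _

lemma isHomog_orderTwoTerm (c c1 c2 q1 q2 q3 q4 : SmoothFun I) :
    ∀ s, IsHomog (orderTwoTerm c c1 c2 q1 q2 q3 q4 s) (3 - s)
  | 0 => jetHomog_cubic _ _ _
  | 1 => jetHomog_quadratic _ _
  | 2 => jetHomog_linear _
  | 3 => jetHomog_C _
  | _ + 4 => isHomog_zero _

lemma isHomog_orderFourTerm (c c1 c2 c3 c4 q1 q2 q3 q4 q5 q6 q7 r : SmoothFun I) :
    ∀ s, IsHomog (orderFourTerm c c1 c2 c3 c4 q1 q2 q3 q4 q5 q6 q7 r s) (5 - s)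
  | 0 => jetHomog_quintic _ _ _ _ _ _ _
  | 1 => jetHomog_quartic _ _ _ _ _
  | 2 => jetHomog_cubic _ _ _
  | 3 => jetHomog_quadratic _ _
  | 4 => jetHomog_linear _
  | 5 => jetHomog_C _
  | _ + 6 => isHomog_zero _

lemma leadingTerm_one : leadingTerm (1 : SmoothFun I) = firstBracket 0 := by
  funext s
  match s with
  | 0 =>
    change C ((1 / 2 : ℝ) • D 1) * ux = 0
    rw [D_one, smul_zero, C_0, zero_mul]
  | 1 => rfl
  | s + 2 => rfl

lemma isGraded_firstBracket : IsGraded (firstBracket (I := I))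
  | 0, s => ⟨fun _ => leadingTerm_one (I := I) ▸ isHomog_leadingTerm 1 s, fun h => by
      obtain ⟨s, rfl⟩ := Nat.exists_eq_add_of_lt h
      rw [← leadingTerm_one, show 0 + 1 + s + 1 = s + 2 by omega]
      rfl⟩
  | _ + 1, _ => ⟨fun _ => isHomog_zero _, fun _ => rfl⟩

lemma isGraded_secondBracket (c q : SmoothFun I) (hq : ∀ x, (D q).1 x ≠ 0) :
    IsGraded (secondBracket c q hq) := by
  refine fun k s => ⟨fun _ => ?_, fun h => ?_⟩
  · match k with
    | 0 => exact isHomog_leadingTerm q s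
    | 2 => exact isHomog_orderTwoTerm _ _ _ _ _ _ _ s
    | 4 => exact isHomog_orderFourTerm _ _ _ _ _ _ _ _ _ _ _ _ _ s
    | 1 | 3 | _ + 5 => exact isHomog_zero _
  · match k, s, h with
    | 0, _ + 2, _ | 1, _, _ | 2, _ + 4, _ | 3, _, _ | 4, _ + 6, _ | _ + 5, _, _ => rfl

lemma IsGraded.pencil {A₁ A₂ : BracketCoeffs I} (h₁ : IsGraded A₁) (h₂ : IsGraded A₂) (lam : ℝ) :
    IsGraded (pencil A₁ A₂ lam) := by
  refine fun k s => ⟨fun h => ?_, fun h => ?_⟩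
  · exact ((h₂ k s).1 h).sub ((weightedHomogeneousSubmodule (SmoothFun I) (fun k : ℕ => k + 1)
      _).smul_of_tower_mem lam ((h₁ k s).1 h))
  · rw [FormalVar.pencil, (h₁ k s).2 h, (h₂ k s).2 h]
    exact sub_smul_zero 0 lam

lemma leadingTerm_skew {A : BracketCoeffs I} (hA : A 0 = leadingTerm q) (f g : DiffPoly I) :
    ∃ r, dx r = f * applyOp A 0 g + g * applyOp A 0 f := by
  have applyOp_zero_eq (h : DiffPoly I) :
      applyOp A 0 h = C q * dx h + C ((1 / 2 : ℝ) • D q) * ux * h := by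
    simp only [applyOp, hA, Finset.sum_range_succ, Finset.sum_range_zero, zero_add]
    exact add_comm _ _
  have two_mul_half : 2 * C ((1 / 2 : ℝ) • D q) = (C (D q) : DiffPoly I) := by
    rw [two_mul, ← C_add, ← add_smul, add_halves, one_smul]
  refine ⟨C q * (f * g), ?_⟩
  rw [applyOp_zero_eq, applyOp_zero_eq]
  simp only [dx_eq, Derivation.leibniz, totalDeriv_C, derivD_apply, smul_eq_mul, ← two_mul_half]
  ring

lemma pencil_zero (c q : SmoothFun I) (hq : ∀ x, (D q).1 x ≠ 0) (lam : ℝ) :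
    pencil firstBracket (secondBracket c q hq) lam 0 = leadingTerm (q - lam • 1) := by
  have D_sub_smul_one : D (q - lam • 1) = D q := by
    rw [D_sub, D_smul, D_one, smul_zero, sub_zero]
  funext s
  match s with
  | 0 =>
    change _ = C ((1 / 2 : ℝ) • D (q - lam • 1)) * ux
    rw [D_sub_smul_one]
    exact sub_smul_zero _ lam
  | 1 => exact C_sub_smul_one q lam
  | _ + 2 => exact sub_smul_zero 0 lam

lemma VanishesMod.pencil {N : ℕ} {A₁ A₂ : BracketCoeffs I} {F G : Density I}
    (h₁ : VanishesMod N (bracket A₁ F G)) (h₂ : VanishesMod N (bracket A₂ F G)) (lam : ℝ) :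
    VanishesMod N (bracket (pencil A₁ A₂ lam) F G) := by
  intro n hn
  obtain ⟨r₁, hr₁⟩ := h₁ n hn
  obtain ⟨r₂, hr₂⟩ := h₂ n hn
  refine ⟨r₂ - lam • r₁, ?_⟩
  rw [bracket_eq, dx_eq] at *
  refine Eq.trans ?_ (jetBracket_pencil (derivD I) A₁ A₂ lam F G n).symm
  rw [← hr₁, ← hr₂, ← Derivation.map_smul]
  exact map_sub (totalDeriv (derivD I)) r₂ (lam • r₁)

end Pencil

section Commutativity

variable {I : TopologicalSpace.Opens ℝ} {c p q : SmoothFun I}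

lemma bracket_apply (A : BracketCoeffs I) (F G : Density I) (n : ℕ) :
    bracket A F G n = ∑ a ∈ antidiagonal n,
      euler (F a.1) * ∑ b ∈ antidiagonal a.2, applyOp A b.1 (euler (G b.2)) := by
  simp only [bracket, Finset.mul_sum]

lemma applyOp_firstBracket_zero (h : DiffPoly I) : applyOp firstBracket 0 h = dx h := by
  simp only [applyOp, Finset.sum_range_succ, Finset.sum_range_zero, zero_add]
  change 0 * h + 1 * dx h = dx h
  rw [zero_mul, one_mul, zero_add]

lemma firstBracket_of_ne_zero {k : ℕ} (hk : k ≠ 0) : firstBracket (I := I) k = 0 := by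
  obtain ⟨k, rfl⟩ := Nat.exists_eq_succ_of_ne_zero hk
  rfl

lemma sum_applyOp_firstBracket (G : Density I) (m : ℕ) :
    ∑ b ∈ antidiagonal m, applyOp firstBracket b.1 (euler (G b.2)) = dx (euler (G m)) := by
  rw [Finset.sum_eq_single_of_mem (0, m) (by simp) fun b hb hne => ?_]
  · exact applyOp_firstBracket_zero _
  · refine applyOp_of_eq_zero (firstBracket_of_ne_zero fun h => hne ?_) _
    rw [mem_antidiagonal, h, zero_add] at hb
    exact Prod.ext h hb

lemma firstBracket_commute (hI : IsConnected (I : Set ℝ)) (c p f g : SmoothFun I) :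
    VanishesMod 6 (bracket firstBracket (hamDensity c p 0 f) (hamDensity c p 0 g)) := by
  intro n hn
  rw [bracket_apply]
  simp only [sum_applyOp_firstBracket]
  simp only [euler_hamDensity]
  exact exists_dx_eq_sum_hamGradient_mul_dx c p f g hI hn

lemma secondBracket_commute (hI : IsConnected (I : Set ℝ)) (hq : ∀ x, (D q).1 x ≠ 0)
    (hp : ∀ x, p.1 x = (5 * c.1 x * (D c).1 x
      - (c.1 x) ^ 2 * ((D^[2] q).1 x / (D q).1 x)) / 960) (f g : SmoothFun I) :
    VanishesMod 6 (bracket (secondBracket c q hq) (hamDensity c p 0 f) (hamDensity c p 0 g)) := by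
  intro n hn
  obtain ⟨t', ht'⟩ := exists_D_eq hI (q * D (D g) + (1 / 2 : ℝ) • (D q * D g))
  obtain ⟨t, rfl⟩ := exists_D_eq hI t'
  obtain ⟨r, hr⟩ := firstBracket_commute hI c p f t n hn
  refine ⟨r, hr.trans ?_⟩
  rw [bracket_apply, bracket_apply]
  refine Finset.sum_congr rfl fun a ha => ?_
  rw [mem_antidiagonal] at ha
  rw [sum_applyOp_firstBracket]
  simp only [euler_hamDensity]
  rw [sum_applyOp_secondBracket_hamGradient hq hp ht' (by omega)]

end Commutativity

lemma hamDensity_zero {I : TopologicalSpace.Opens ℝ} (c p s f : SmoothFun I) :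
    hamDensity c p s f 0 = C f := rfl

end FormalVar

end

theorem mainTheorem6
    (I : TopologicalSpace.Opens ℝ) (hI : IsConnected (I : Set ℝ))
    (c q : FormalVar.SmoothFun I)
    (hq : ∀ x, (FormalVar.D q).1 x ≠ 0)
    (p : FormalVar.SmoothFun I)
    (hp : ∀ x, p.1 x = (5 * c.1 x * (FormalVar.D c).1 x
      - (c.1 x) ^ 2 * ((FormalVar.D^[2] q).1 x / (FormalVar.D q).1 x)) / 960) :
    -- commutativity with respect to the first and to the second bracket
    (∀ f g : FormalVar.SmoothFun I, FormalVar.VanishesMod 6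
      (FormalVar.bracket FormalVar.firstBracket
        (FormalVar.hamDensity c p 0 f) (FormalVar.hamDensity c p 0 g))) ∧
    (∀ f g : FormalVar.SmoothFun I, FormalVar.VanishesMod 6
      (FormalVar.bracket (FormalVar.secondBracket c q hq)
        (FormalVar.hamDensity c p 0 f) (FormalVar.hamDensity c p 0 g))) ∧
    -- the two brackets form a Poisson pencil
    FormalVar.IsPoissonMod 6 (FormalVar.firstBracket (I := I)) ∧
    (∀ lam : ℝ, FormalVar.IsPoissonMod 6
      (FormalVar.pencil FormalVar.firstBracket (FormalVar.secondBracket c q hq) lam)) ∧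
    -- the second bracket is a graded deformation of its leading term, and the only one with
    -- respect to which the Hamiltonians commute
    FormalVar.IsGraded (FormalVar.secondBracket c q hq) ∧
    (∀ A : FormalVar.BracketCoeffs I, FormalVar.IsGraded A → A 0 = FormalVar.leadingTerm q →
      (∀ f g : FormalVar.SmoothFun I, FormalVar.VanishesMod 6
        (FormalVar.bracket A (FormalVar.hamDensity c p 0 f) (FormalVar.hamDensity c p 0 g))) →
      ∀ k < 6, A k = FormalVar.secondBracket c q hq k) := by
  have commute_first := FormalVar.firstBracket_commute hI c p
  have commute_second := FormalVar.secondBracket_commute hI hq hp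
  have graded_first := FormalVar.isGraded_firstBracket (I := I)
  have graded_second := FormalVar.isGraded_secondBracket c q hq
  have leading := FormalVar.hamDensity_zero c p 0
  refine ⟨commute_first, commute_second, ?_, fun lam => ?_, graded_second, fun A hA hA0 hAH => ?_⟩
  · exact graded_first.isPoissonMod_of_commute hI leading commute_first
      (FormalVar.leadingTerm_skew FormalVar.leadingTerm_one.symm)
  · exact (graded_first.pencil graded_second lam).isPoissonMod_of_commute hI leading
      (fun f g => (commute_first f g).pencil (commute_second f g) lam)
      (FormalVar.leadingTerm_skew (FormalVar.pencil_zero c q hq lam))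
  · exact hA.eq_of_commute hI graded_second leading hAH commute_second hA0
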